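/- **Conventions.** $\mathbf C$ is an essentially small category with pushouts. Ind-objects of $\mathbf C$ are regarded as presheaves of sets on $\mathbf C$ (filtered colimits of representables), and $X^n:=X(n)$. A commutative square of ordered sets with maps $f:A\to B$, $g:A\to C$, $u:B\to D$, $v:C\to D$ has the *interpolation property* if $u(b)\le v(c)$ implies that there is $a\in A$ with $b\le f(a)$ and $g(a)\le c$. An order-preserving map is *bounded* if it sends up-sets to up-sets. A *compact ordered space* is a compact space with a closed partial order; morphisms are the continuous order-preserving maps. The compactification $\beta A$ of a preorder $A$ is the Priestley dual of its lattice of up-sets. A *$\mathbf C$-adic compact ordered space* is a functor $S$ from $\mathbf C^{\mathrm{op}}$ to compact ordered spaces that sends all maps to bounded maps and pushout squares of $\mathbf C$ to squares with the interpolation property. It is *open* if every $S(\sigma)$ sends open up-sets to open up-sets, and *intuitionistic* if ${\downarrow}W$ is open for every open $W\subseteq S(n)$, and, for every $\sigma:n\to m$, ${\uparrow}S(\sigma)[U]$ (resp. ${\downarrow}S(\sigma)[U]$) is open for every open up-set (resp. open down-set) $U\subseteq S(m)$. A natural transformation $\tau:S\to T$ is a *morphism* if for all $\sigma:n\to m$,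 $t\in T(m)$, $s\in S(n)$ with $T(\sigma)(t)\le\tau_n(s)$ there is $s'\in S(m)$ with $t\le\tau_m(s')$ and $S(\sigma)(s')\le s$. It is *intuitionistic* if moreover every $\tau_n$ is bounded and, whenever $\tau_n(s)\le T(\sigma)(t)$, there is $s'\in S(m)$ with $s\le S(\sigma)(s')$ and $\tau_m(s')\le t$. A *model* of an open $S$ is an ind-object $X$ with a natural transformation $x:X\to S$ whose continuous extension $\beta\circ X\to S$ is a morphism; a morphism of models $(X,x)\to(Y,y)$ is $h:X\to Y$ with $x\le y\circ h$. For a functor $G:\mathbf I\to\mathrm{Mod}(S)$, $i\mapsto(X_i,x_i)$, let $\tilde F(n)$ be the preorder of pairs $(i,p)$, $p\in X_i^n$, with $(i,p)\le(j,q)$ iff some $i\to j$ sends $p$ to $q$. If $S$ is intuitionistic, $G$ is a *Kripke model* of $S$ if the induced map $\tilde F\to S$, $(i,p)\mapsto x_i(p)$, extends to an intuitionistic morphism $\beta\circ\tilde F\to S$. **Proposition (Craig interpolation).** (1) Let $S\xrightarrow{f}P\xleftarrow{g}Q$ be intuitionistic morphisms of $\mathbf C$-adic compact ordered spaces, with $S$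 and $Q$ open. Let $\mathbf B$ be the category of triples $(X,x,y)$, where $X$ is an ind-object, $x:X\to S$ and $y:X\to Q$ are models and $f\circ x=g\circ y$, whose morphisms $(X,x,y)\to(X',x',y')$ are the $h:X\to X'$ with $x\le x'\circ h$ and $y\le y'\circ h$. Let $\tilde F$ be formed from $\mathbf B$. Then the projections $\mathbf B\to\mathrm{Mod}(S)$ and $\mathbf B\to\mathrm{Mod}(Q)$ satisfy the Kripke conditions: with $T=S$ (resp. $T=Q$) and $\pi:\tilde F\to T$ the induced map, * (implication) every $\pi_n:\tilde F(n)\to T(n)$ is bounded; * (universal quantification) for $\sigma:n\to m$, $z\in\tilde F(n)$ and $t\in T(m)$ with $\pi_n(z)\le T(\sigma)(t)$ there is $z'\in\tilde F(m)$ with $z\le\tilde F(\sigma)(z')$ and $\pi_m(z')\le t$. Consequently, if $S$ (resp. $Q$) is intuitionistic, then $\mathbf B\to\mathrm{Mod}(S)$ (resp. $\mathbf B\to\mathrm{Mod}(Q)$) is a Kripke model. Moreover the square formed by $\tilde F\to S\to P$ and $\tilde F\to Q\to P$ has the interpolation property at each $n$, in both directions: if $f(s)\le g(q)$ with $s\in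 S(n)$, $q\in Q(n)$, then there is a point $p\in X^n$ of some $(X,x,y)\in\mathbf B$ with $s\le x(p)$ and $y(p)\le q$; and if $g(q)\le f(s)$ then there is one with $q\le y(p)$ and $x(p)\le s$. (2) (Dual form: Craig interpolation for first-order intuitionistic logic.) Recall that an *intuitionistic hyperdoctrine* is a functor $D$ from $\mathbf C$ to Heyting algebras such that every $D(\sigma)$ has a left and a right adjoint and pushout squares are sent to squares with the interpolation property (over finite sets, these are the algebras of formulas of intuitionistic first-order theories). A *morphism* is a natural transformation (by Heyting homomorphisms) $\tau:D\to D'$ whose naturality squares have the interpolation property in both directions, that is, which commutes with these adjoints (quantifiers). Let $a:D_0\to D_1$ and $b:D_0\to D_2$ be morphisms of intuitionistic hyperdoctrines over $\mathbf C$. Then there are an intuitionistic hyperdoctrine $E$ and morphisms $c:D_1\to E$, $d:D_2\to E$ with $c\circ a=d\circ b$ such that, for each $n$, the square of $a_n,b_n,c_n,d_n$ has the interpolation property in both directions: if $c(\varphi)\le d(\psi)$ then there is $\theta\in D_0(n)$ with $\varphi\le a(\theta)$ and $b(\theta)\le\psi$, and likewise with the roles of $D_1$ and $D_2$ exchanged.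 In particular, if $\varphi\in D_1(n)$ entails $\psi\in D_2(n)$ in every common extension, i.e. $c(\varphi)\le d(\psi)$ for all intuitionistic hyperdoctrines $E$ and morphisms $c:D_1\to E$, $d:D_2\to E$ with $c\circ a=d\circ b$, then there is $\theta\in D_0(n)$ with $\varphi\le a(\theta)$ and $b(\theta)\le\psi$. -/

import Mathlib

open CategoryTheory CategoryTheory.Limits Opposite

universe u v w u₁ v₁ w₁ w₂

namespace Polyadic

/-! ### Interpolation, bounded maps, semi-open maps -/

/-- The interpolation property of the lax square `u ∘ f ≤ v ∘ g`, where `f : A → B`, `g : A → C`,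
`u : B → D`, `v : C → D`: whenever `u b ≤ v c` there is `a` with `b ≤ f a` and `g a ≤ c`. -/
def Interpolation {A : Type*} {B : Type*} {C : Type*} {D : Type*} [LE B] [LE C] [LE D]
    (f : A → B) (g : A → C) (u : B → D) (v : C → D) : Prop :=
  ∀ (b : B) (c : C), u b ≤ v c → ∃ a : A, b ≤ f a ∧ g a ≤ c

/-- A map is bounded if direct images of up-sets are up-sets. -/
def IsBoundedMap {A : Type*} {B : Type*} [LE A] [LE B] (f : A → B) : Prop :=
  ∀ U : Set A, IsUpperSet U → IsUpperSet (f '' U)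

/-- A map is lower semi-open if direct images of open up-sets are open up-sets. -/
def IsLowerSemiOpen {A : Type*} {B : Type*} [LE A] [LE B] [TopologicalSpace A]
    [TopologicalSpace B] (f : A → B) : Prop :=
  ∀ U : Set A, IsOpen U → IsUpperSet U → IsOpen (f '' U) ∧ IsUpperSet (f '' U)

/-! ### Compact ordered spaces -/

/-- Compact ordered spaces: compact spaces with a closed partial order. -/
structure KOrd : Type (w + 1) where
  carrier : Type w
  [top : TopologicalSpace carrier]
  [ord : PartialOrder carrier]
  [compact : CompactSpace carrier]
  [closed : OrderClosedTopology carrier]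

namespace KOrd

instance : CoeSort KOrd.{w} (Type w) := ⟨KOrd.carrier⟩

attribute [instance] KOrd.top KOrd.ord KOrd.compact KOrd.closed

/-- Morphisms of compact ordered spaces: continuous order-preserving maps. -/
@[ext]
structure Hom (X Y : KOrd.{w}) where
  hom : X →Co Y

instance : Category KOrd.{w} where
  Hom X Y := Hom X Y
  id X := ⟨ContinuousOrderHom.id X⟩
  comp f g := ⟨g.hom.comp f.hom⟩

instance : ConcreteCategory KOrd.{w} (fun X Y => X →Co Y) where
  hom f := f.hom
  ofHom f := ⟨f⟩

end KOrd

/-! ### The ordered Stone–Čech compactification -/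

/-- The points of the Priestley dual of a bounded distributive lattice `L`: lattice homomorphisms
from `L` to the two-element lattice. -/
@[ext]
structure Spec (L : Type*) [DistribLattice L] [BoundedOrder L] where
  val : L → Bool
  map_top : val ⊤ = true
  map_bot : val ⊥ = false
  map_sup : ∀ a b, val (a ⊔ b) = (val a || val b)
  map_inf : ∀ a b, val (a ⊓ b) = (val a && val b)

namespace Spec

variable {L : Type*} [DistribLattice L] [BoundedOrder L]

theorem val_injective : Function.Injective (val : Spec L → L → Bool) := fun _ _ => Spec.ext

/-- The pointwise order. -/
instance : PartialOrder (Spec L) where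
  le x y := ∀ a, x.val a = true → y.val a = true
  le_refl _ _ h := h
  le_trans _ _ _ h h' a ha := h' a (h a ha)
  le_antisymm x y h h' := Spec.ext (funext fun a => Bool.eq_iff_iff.2 ⟨h a, h' a⟩)

/-- The topology inherited from the product topology, with `Bool` discrete. -/
instance : TopologicalSpace (Spec L) := TopologicalSpace.induced val inferInstance

theorem le_iff {x y : Spec L} : x ≤ y ↔ ∀ a, x.val a = true → y.val a = true := Iff.rfl

theorem continuous_val (a : L) : Continuous fun x : Spec L => x.val a :=
  (continuous_apply a).comp continuous_induced_dom

theorem range_val : Set.range (val : Spec L → L → Bool) =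
    {φ | φ ⊤ = true} ∩ {φ | φ ⊥ = false} ∩
      ((⋂ a, ⋂ b, {φ | φ (a ⊔ b) = (φ a || φ b)}) ∩
        ⋂ a, ⋂ b, {φ | φ (a ⊓ b) = (φ a && φ b)}) := by
  ext φ
  simp only [Set.mem_range, Set.mem_inter_iff, Set.mem_iInter]
  constructor
  · rintro ⟨x, rfl⟩
    exact ⟨⟨x.map_top, x.map_bot⟩, x.map_sup, x.map_inf⟩
  · rintro ⟨⟨h1, h2⟩, h3, h4⟩
    exact ⟨⟨φ, h1, h2, h3, h4⟩, rfl⟩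

instance : CompactSpace (Spec L) := by
  refine Topology.IsClosedEmbedding.compactSpace (f := (val : Spec L → L → Bool))
    ⟨⟨⟨rfl⟩, val_injective⟩, ?_⟩
  rw [range_val]
  have hs : Continuous fun p : Bool × Bool => (p.1 || p.2) := continuous_of_discreteTopology
  have hi : Continuous fun p : Bool × Bool => (p.1 && p.2) := continuous_of_discreteTopology
  have h2 : ∀ a b : L, Continuous fun φ : L → Bool => (φ a, φ b) :=
    fun a b => (continuous_apply a).prodMk (continuous_apply b)
  refine ((isClosed_eq (continuous_apply _) continuous_const).inter
    (isClosed_eq (continuous_apply _) continuous_const)).inter (IsClosed.inter ?_ ?_)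
  · exact isClosed_iInter fun a => isClosed_iInter fun b =>
      isClosed_eq (continuous_apply _) (hs.comp (h2 a b))
  · exact isClosed_iInter fun a => isClosed_iInter fun b =>
      isClosed_eq (continuous_apply _) (hi.comp (h2 a b))

instance : OrderClosedTopology (Spec L) where
  isClosed_le' := by
    have h : {p : Spec L × Spec L | p.1 ≤ p.2} =
        ⋂ a, (fun p : Spec L × Spec L => (p.1.val a, p.2.val a)) ⁻¹'
          {q | q.1 = true → q.2 = true} := by
      ext p
      simp [le_iff]
    rw [h]
    exact isClosed_iInter fun a => (isClosed_discrete _).preimage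
      (((continuous_val a).comp continuous_fst).prodMk ((continuous_val a).comp continuous_snd))

end Spec

/-- The lattice of up-sets of a preorder, ordered by inclusion (Mathlib orders `UpperSet` by
reverse inclusion). -/
abbrev Up (A : Type*) [Preorder A] := (UpperSet A)ᵒᵈ

/-- The preimage of an up-set under an order-preserving map. -/
def Up.comap {A B : Type*} [Preorder A] [Preorder B] (f : A →o B) (U : Up B) : Up A :=
  OrderDual.toDual ⟨f ⁻¹' (OrderDual.ofDual U : UpperSet B),
    (OrderDual.ofDual U).upper.preimage f.monotone⟩

/-- The ordered Stone–Čech compactification of a preorder: the Priestley dual of its lattice of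
up-sets. -/
abbrev Beta (A : Type*) [Preorder A] := Spec (Up A)

open Classical in
/-- The canonical map from a preorder to its ordered Stone–Čech compactification; it sends `a` to
the prime filter of up-sets that contain `a`. -/
noncomputable def Beta.unit {A : Type*} [Preorder A] (a : A) : Beta A where
  val U := decide (a ∈ (OrderDual.ofDual U : UpperSet A))
  map_top := decide_eq_true (show a ∈ (⊥ : UpperSet A) from trivial)
  map_bot := decide_eq_false (show ¬ a ∈ (⊤ : UpperSet A) from id)
  map_sup U V := by
    rw [← Bool.decide_or]
    exact decide_eq_decide.2 Iff.rfl
  map_inf U V := by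
    rw [← Bool.decide_and]
    exact decide_eq_decide.2 Iff.rfl

/-- Functoriality of the ordered Stone–Čech compactification. -/
def Beta.map {A B : Type*} [Preorder A] [Preorder B] (f : A →o B) : Beta A →Co Beta B where
  toFun x :=
    { val := fun U => x.val (Up.comap f U)
      map_top := x.map_top
      map_bot := x.map_bot
      map_sup := fun U V => x.map_sup (Up.comap f U) (Up.comap f V)
      map_inf := fun U V => x.map_inf (Up.comap f U) (Up.comap f V) }
  monotone' _ _ h U := h (Up.comap f U)
  continuous_toFun := continuous_induced_rng.2
    (continuous_pi fun U => Spec.continuous_val (Up.comap f U))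

/-- The ordered Stone–Čech compactification as a functor. -/
def beta : Preord.{w} ⥤ KOrd.{w} where
  obj A := ⟨Beta A⟩
  map f := ⟨Beta.map f.hom⟩
  map_id _ := rfl
  map_comp _ _ := rfl

variable {C : Type u} [Category.{v} C]

/-! ### Polyadic compact ordered spaces and their morphisms -/

/-- `S` is a polyadic compact ordered space over `C`. -/
structure IsPolyadic (S : Cᵒᵖ ⥤ KOrd.{w}) : Prop where
  /-- Pushout squares are sent to squares with the interpolation property. -/
  interpolation : ∀ {n m m' k : C} {f : n ⟶ m} {g : n ⟶ m'} {a : m ⟶ k} {b : m' ⟶ k},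
    IsPushout f g a b →
      Interpolation (S.map a.op) (S.map b.op) (S.map f.op) (S.map g.op)
  bounded : ∀ {n m : C} (σ : n ⟶ m), IsBoundedMap (S.map σ.op)

/-- `S` is open: all restriction maps are lower semi-open. -/
def IsOpenPolyadic (S : Cᵒᵖ ⥤ KOrd.{w}) : Prop :=
  ∀ {n m : C} (σ : n ⟶ m), IsLowerSemiOpen (S.map σ.op)

/-- `S` is an intuitionistic polyadic compact ordered space: it is polyadic and satisfies the
openness conditions for implication, existential and universal quantification. -/
structure IsIntuitionisticPolyadic (S : Cᵒᵖ ⥤ KOrd.{w}) : Prop extends IsPolyadic S where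
  isOpen_imp : ∀ (n : C) (W : Set (S.obj (op n))), IsOpen W →
    IsOpen (lowerClosure W : Set (S.obj (op n)))
  isOpen_exists : ∀ {n m : C} (σ : n ⟶ m) (U : Set (S.obj (op m))), IsOpen U → IsUpperSet U →
    IsOpen (upperClosure (S.map σ.op '' U) : Set (S.obj (op n)))
  isOpen_forall : ∀ {n m : C} (σ : n ⟶ m) (U : Set (S.obj (op m))), IsOpen U → IsLowerSet U →
    IsOpen (lowerClosure (S.map σ.op '' U) : Set (S.obj (op n)))

/-- Natural transformations between presheaves of compact ordered spaces (the two presheaves may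
live in different universes). -/
structure KOrdTrans (S : Cᵒᵖ ⥤ KOrd.{w₁}) (T : Cᵒᵖ ⥤ KOrd.{w₂}) where
  app : ∀ n : C, S.obj (op n) →Co T.obj (op n)
  naturality : ∀ {n m : C} (σ : n ⟶ m) (s : S.obj (op m)),
    app n (S.map σ.op s) = T.map σ.op (app m s)

/-- Morphisms of polyadic compact ordered spaces. -/
def KOrdTrans.IsMorphism {S : Cᵒᵖ ⥤ KOrd.{w₁}} {T : Cᵒᵖ ⥤ KOrd.{w₂}} (τ : KOrdTrans S T) :
    Prop :=
  ∀ {n m : C} (σ : n ⟶ m), Interpolation (τ.app m) (S.map σ.op) (T.map σ.op) (τ.app n)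

/-- Intuitionistic morphisms: pointwise bounded, and the naturality squares have the interpolation
property in both directions. -/
structure KOrdTrans.IsIntuitionistic {S : Cᵒᵖ ⥤ KOrd.{w₁}} {T : Cᵒᵖ ⥤ KOrd.{w₂}}
    (τ : KOrdTrans S T) : Prop where
  isMorphism : τ.IsMorphism
  bounded : ∀ n : C, IsBoundedMap (τ.app n)
  back : ∀ {n m : C} (σ : n ⟶ m),
    Interpolation (S.map σ.op) (τ.app m) (τ.app n) (T.map σ.op)

/-- Natural transformations from a presheaf of preorders to a presheaf of compact ordered
spaces. -/
structure OrdTrans (K : Cᵒᵖ ⥤ Preord.{w₁}) (S : Cᵒᵖ ⥤ KOrd.{w₂}) where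
  app : ∀ n : C, K.obj (op n) →o S.obj (op n)
  naturality : ∀ {n m : C} (σ : n ⟶ m) (p : K.obj (op m)),
    app n (K.map σ.op p) = S.map σ.op (app m p)

/-- `τ : β ∘ K → S` is the extension by continuity of `x : K → S`. -/
def KOrdTrans.Extends {K : Cᵒᵖ ⥤ Preord.{w₁}} {S : Cᵒᵖ ⥤ KOrd.{w₂}}
    (τ : KOrdTrans (K ⋙ beta) S) (x : OrdTrans K S) : Prop :=
  ∀ (n : C) (p : K.obj (op n)), τ.app n (Beta.unit p) = x.app n p

/-! ### Types and models -/

/-- A set with the discrete order. -/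
def DiscreteOrder (A : Type w) : Type w := A

instance (A : Type w) : Preorder (DiscreteOrder A) where
  le := Eq
  le_refl _ := rfl
  le_trans _ _ _ := Eq.trans

/-- Sets as discretely ordered sets. -/
def discrete : Type w ⥤ Preord.{w} where
  obj A := Preord.of (DiscreteOrder A)
  map {A B} f := Preord.ofHom
    { toFun := fun a : DiscreteOrder A => (f (show A from a) : B)
      monotone' := fun _ _ h => congrArg (fun a : A => f a) h }
  map_id _ := rfl
  map_comp _ _ := rfl

/-- An `X`-type of `S`: a natural transformation from the presheaf of sets `X` to `S`. -/
structure TypeOver (X : Cᵒᵖ ⥤ Type w₁) (S : Cᵒᵖ ⥤ KOrd.{w₂}) where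
  app : ∀ n : C, X.obj (op n) → S.obj (op n)
  naturality : ∀ {n m : C} (σ : n ⟶ m) (p : X.obj (op m)),
    app n (X.map σ.op p) = S.map σ.op (app m p)

/-- An `X`-type of `S`, with `X` seen as a presheaf of discrete orders. -/
def TypeOver.toOrdTrans {X : Cᵒᵖ ⥤ Type w₁} {S : Cᵒᵖ ⥤ KOrd.{w₂}} (x : TypeOver X S) :
    OrdTrans (X ⋙ discrete) S where
  app n :=
    { toFun := x.app n
      monotone' := fun p q h => le_of_eq (congrArg (x.app n) (show p = q from h)) }
  naturality := x.naturality

/-- `x : X → S` is an `S`-structure: it extends to a morphism `β ∘ X → S` of polyadic spaces. -/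
def TypeOver.IsStructure {X : Cᵒᵖ ⥤ Type w₁} {S : Cᵒᵖ ⥤ KOrd.{w₂}} (x : TypeOver X S) : Prop :=
  ∃ τ : KOrdTrans ((X ⋙ discrete) ⋙ beta) S, τ.Extends x.toOrdTrans ∧ τ.IsMorphism

/-- Models of `S`: ind-objects of `C` (realized as presheaves) with an `S`-structure. -/
structure Model (S : Cᵒᵖ ⥤ KOrd.{w}) where
  X : Cᵒᵖ ⥤ Type v
  isInd : IsIndObject X
  type : TypeOver X S
  isStructure : type.IsStructure

/-- Morphisms of models: morphisms `h : X ⟶ Y` of ind-objects such that `x ≤ y ∘ h`. -/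
@[ext]
structure Model.Hom {S : Cᵒᵖ ⥤ KOrd.{w}} (M N : Model S) where
  hom : M.X ⟶ N.X
  le : ∀ (n : C) (p : M.X.obj (op n)), M.type.app n p ≤ N.type.app n (hom.app (op n) p)

instance (S : Cᵒᵖ ⥤ KOrd.{w}) : Category (Model S) where
  Hom M N := Model.Hom M N
  id M := ⟨𝟙 _, fun _ _ => le_rfl⟩
  comp f g := ⟨f.hom ≫ g.hom, fun n p => (f.le n p).trans (g.le n _)⟩

/-- The underlying ind-object of a model. -/
def Model.forget (S : Cᵒᵖ ⥤ KOrd.{w}) : Model S ⥤ Cᵒᵖ ⥤ Type v where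
  obj M := M.X
  map f := Model.Hom.hom f

/-! ### Kripke models -/

section Kripke

variable {I : Type u₁} [Category.{v₁} I]

/-- The value at `n` of the oplax colimit of a diagram of presheaves of sets: pairs `(i, p)` with
`p` an `n`-point of `F i`. -/
def OplaxPoint (F : I ⥤ Cᵒᵖ ⥤ Type v) (n : Cᵒᵖ) : Type (max u₁ v) :=
  Σ i : I, (F.obj i).obj n

/-- `(i, p) ≤ (j, q)` if some arrow `i ⟶ j` sends `p` to `q`. -/
instance (F : I ⥤ Cᵒᵖ ⥤ Type v) (n : Cᵒᵖ) : Preorder (OplaxPoint F n) where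
  le a b := ∃ h : a.1 ⟶ b.1, (F.map h).app n a.2 = b.2
  le_refl a := ⟨𝟙 _, by simp⟩
  le_trans := by
    rintro ⟨i, p⟩ ⟨j, q⟩ ⟨k, r⟩ ⟨h, hh⟩ ⟨h', hh'⟩
    refine ⟨h ≫ h', ?_⟩
    simp only at hh hh' ⊢
    simp [hh, hh']

/-- The oplax colimit of a diagram of presheaves of sets, as a presheaf of preorders. -/
def oplaxColimit (F : I ⥤ Cᵒᵖ ⥤ Type v) : Cᵒᵖ ⥤ Preord.{max u₁ v} where
  obj n := Preord.of (OplaxPoint F n)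
  map {n m} σ := Preord.ofHom
    { toFun := fun a => ⟨a.1, (F.obj a.1).map σ a.2⟩
      monotone' := by
        rintro ⟨i, p⟩ ⟨j, q⟩ ⟨h, hh⟩
        refine ⟨h, ?_⟩
        simp only at hh ⊢
        rw [← hh]
        exact NatTrans.naturality_apply (F.map h) σ p }
  map_id n := by
    ext a
    exact Sigma.ext rfl (heq_of_eq
      (congrArg (fun h => (ConcreteCategory.hom h) a.2) ((F.obj a.1).map_id n)))
  map_comp f g := by
    ext a
    exact Sigma.ext rfl (heq_of_eq
      (congrArg (fun h => (ConcreteCategory.hom h) a.2) ((F.obj a.1).map_comp f g)))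

variable {S : Cᵒᵖ ⥤ KOrd.{w}}

/-- The natural transformation from the oplax colimit of the underlying ind-objects to `S` that
corresponds to a diagram of models of `S`. -/
def diagramTrans (G : I ⥤ Model S) : OrdTrans (oplaxColimit (G ⋙ Model.forget S)) S where
  app n :=
    { toFun := fun a => (G.obj a.1).type.app n a.2
      monotone' := by
        rintro ⟨i, p⟩ ⟨j, q⟩ ⟨h, hh⟩
        have h1 := Model.Hom.le (G.map h) n p
        have h2 : (Model.Hom.hom (G.map h)).app (op n) p = q := hh
        rw [h2] at h1
        exact h1 }
  naturality σ a := (G.obj a.1).type.naturality σ a.2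

/-- A diagram of models is a Kripke model of the intuitionistic polyadic space `S` if the induced
transformation extends to an intuitionistic morphism from the compactification of the oplax colimit
to `S`. -/
def IsKripkeModel (G : I ⥤ Model S) : Prop :=
  ∃ τ : KOrdTrans (oplaxColimit (G ⋙ Model.forget S) ⋙ beta) S,
    τ.Extends (diagramTrans G) ∧ τ.IsIntuitionistic

/-- The explicit Kripke conditions (implication and universal quantification) on a diagram of
models; they make sense for every open polyadic space `S`. -/
structure KripkeConditions (G : I ⥤ Model S) : Prop where
  implication : ∀ n : C, IsBoundedMap ((diagramTrans G).app n)
  universal : ∀ {n m : C} (σ : n ⟶ m),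
    Interpolation ((oplaxColimit (G ⋙ Model.forget S)).map σ.op) ((diagramTrans G).app m)
      ((diagramTrans G).app n) (S.map σ.op)

end Kripke

/-! ### Pairs of models that agree over a cospan -/

/-- Pairs of models of `S` and `Q` on the same ind-object that agree over `P`. -/
structure AgreeingPair {S P Q : Cᵒᵖ ⥤ KOrd.{w}} (f : KOrdTrans S P) (g : KOrdTrans Q P) where
  X : Cᵒᵖ ⥤ Type v
  isInd : IsIndObject X
  left : TypeOver X S
  left_isStructure : left.IsStructure
  right : TypeOver X Q
  right_isStructure : right.IsStructure
  agree : ∀ (n : C) (p : X.obj (op n)), f.app n (left.app n p) = g.app n (right.app n p)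

namespace AgreeingPair

variable {S P Q : Cᵒᵖ ⥤ KOrd.{w}} {f : KOrdTrans S P} {g : KOrdTrans Q P}

/-- Morphisms of ind-objects that are morphisms for both model structures. -/
@[ext]
structure Hom (M N : AgreeingPair f g) where
  hom : M.X ⟶ N.X
  left_le : ∀ (n : C) (p : M.X.obj (op n)), M.left.app n p ≤ N.left.app n (hom.app (op n) p)
  right_le : ∀ (n : C) (p : M.X.obj (op n)), M.right.app n p ≤ N.right.app n (hom.app (op n) p)

instance : Category (AgreeingPair f g) where
  Hom M N := Hom M N
  id M := ⟨𝟙 _, fun _ _ => le_rfl, fun _ _ => le_rfl⟩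
  comp a b := ⟨a.hom ≫ b.hom, fun n p => (a.left_le n p).trans (b.left_le n _),
    fun n p => (a.right_le n p).trans (b.right_le n _)⟩

/-- The projection to models of `S`. -/
def projLeft (f : KOrdTrans S P) (g : KOrdTrans Q P) : AgreeingPair f g ⥤ Model S where
  obj M := ⟨M.X, M.isInd, M.left, M.left_isStructure⟩
  map a := ⟨Hom.hom a, Hom.left_le a⟩

/-- The projection to models of `Q`. -/
def projRight (f : KOrdTrans S P) (g : KOrdTrans Q P) : AgreeingPair f g ⥤ Model Q where
  obj M := ⟨M.X, M.isInd, M.right, M.right_isStructure⟩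
  map a := ⟨Hom.hom a, Hom.right_le a⟩

/-- An `n`-point of an agreeing pair. -/
def Point (f : KOrdTrans S P) (g : KOrdTrans Q P) (n : C) :=
  Σ M : AgreeingPair f g, M.X.obj (op n)

/-- The type in `S` of an `n`-point of an agreeing pair. -/
def Point.left {n : C} (z : Point f g n) : S.obj (op n) := z.1.left.app n z.2

/-- The type in `Q` of an `n`-point of an agreeing pair. -/
def Point.right {n : C} (z : Point f g n) : Q.obj (op n) := z.1.right.app n z.2

end AgreeingPair

/-! ### Intuitionistic hyperdoctrines -/

/-- `D` is an intuitionistic hyperdoctrine (a covariant functor on a category of small objects). -/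
structure IsIntuitionisticHyperdoctrine (D : C ⥤ HeytAlg.{w}) : Prop where
  /-- Pushout squares are sent to squares with the interpolation property. -/
  interpolation : ∀ {n m m' k : C} {f : n ⟶ m} {g : n ⟶ m'} {a : m ⟶ k} {b : m' ⟶ k},
    IsPushout f g a b → Interpolation (D.map f) (D.map g) (D.map a) (D.map b)
  exists_leftAdjoint : ∀ {n m : C} (σ : n ⟶ m),
    ∃ l : D.obj m → D.obj n, GaloisConnection l (D.map σ)
  exists_rightAdjoint : ∀ {n m : C} (σ : n ⟶ m),
    ∃ r : D.obj m → D.obj n, GaloisConnection (D.map σ) r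

/-- Morphisms of intuitionistic hyperdoctrines: the naturality squares have the interpolation
property in both directions. -/
structure IsHyperdoctrineMorphism {D₁ D₂ : C ⥤ HeytAlg.{w}} (τ : D₁ ⟶ D₂) : Prop where
  forth : ∀ {n m : C} (σ : n ⟶ m),
    Interpolation (D₁.map σ) (τ.app n) (τ.app m) (D₂.map σ)
  back : ∀ {n m : C} (σ : n ⟶ m),
    Interpolation (τ.app n) (D₁.map σ) (D₂.map σ) (τ.app m)

end Polyadic

namespace Polyadic

/-! ### Separation in compact ordered spaces -/

section Separation

variable {K : Type*} [TopologicalSpace K] [PartialOrder K] [CompactSpace K]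
  [OrderClosedTopology K]

/-! Types on an ind-object behave like points of a polyadic space. An ind-object is a directed
colimit of representables, a type on it is a compatible family of points at the stages, and
compactness (`DirectedPresentation.exists_type`) realizes any compatible system of nonempty closed
conditions. Boundedness and both interpolation properties therefore pass from objects of `C` to
ind-objects.

Pairs of models are built by a Henkin construction. All missing witnesses for `S` are adjoined at
once by pushouts (`exists_adjunction_of_points`), with the left type extended exactly. The
interpolation property of `g` supplies a right type whose image in `P` lies below that of the left
one, and boundedness of `g` raises it until the two agree. Raising might alter the right type on the
old points, which would destroy witnesses found earlier. This is excluded by keeping the right type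
maximal among types with its image in `P` (Zorn): the restriction of the new type lies above the old
one and has the same image, hence equals it. Witnesses for `Q` are treated similarly, after the left
type has been chosen by interpolation for `f`. Since all restrictions are exact, the union of an
omega-chain of such steps is a pair of models (`MaximalPair.exists_agreeingPair`).

Starting from a pair of models with one point adjoined, the construction gives the Kripke
conditions; starting from a representable, it gives interpolation for the square. Prime separation
in the lattice of up-sets, together with the openness conditions, carries these facts from points to
the compactification.

For hyperdoctrines, spectra turn the span into a cospan of open polyadic spaces and intuitionistic
morphisms. If there is no interpolant, prime separation yields comparable points of the two spectra
(`Spec.exists_of_no_interpolant`), and a pair of models realizes them. The amalgam `E` is the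
hyperdoctrine of up-sets of the points of a small family of pairs closed under the extensions above;
the Kripke conditions say that interpreting formulas by up-sets commutes with implication and
universal quantification. -/

theorem isClosed_lowerClosure_of_isClosed {s : Set K} (hs : IsClosed s) :
    IsClosed (lowerClosure s : Set K) := by
  have h : (lowerClosure s : Set K) = Prod.fst '' ({p : K × K | p.1 ≤ p.2} ∩ Prod.snd ⁻¹' s) := by
    ext a
    simp only [SetLike.mem_coe, mem_lowerClosure, Set.mem_image, Set.mem_inter_iff, Set.mem_ofPred_eq,
      Set.mem_preimage, Prod.exists]
    constructor
    · rintro ⟨b, hb, hab⟩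
      exact ⟨a, b, ⟨hab, hb⟩, rfl⟩
    · rintro ⟨a', b, ⟨hab, hb⟩, rfl⟩
      exact ⟨b, hb, hab⟩
  rw [h]
  exact (((OrderClosedTopology.isClosed_le').inter
    (hs.preimage continuous_snd)).isCompact.image continuous_fst).isClosed

theorem isClosed_upperClosure_of_isClosed {s : Set K} (hs : IsClosed s) :
    IsClosed (upperClosure s : Set K) := by
  have h : (upperClosure s : Set K) = Prod.snd '' ({p : K × K | p.1 ≤ p.2} ∩ Prod.fst ⁻¹' s) := by
    ext a
    simp only [SetLike.mem_coe, mem_upperClosure, Set.mem_image, Set.mem_inter_iff, Set.mem_ofPred_eq,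
      Set.mem_preimage, Prod.exists]
    constructor
    · rintro ⟨b, hb, hab⟩
      exact ⟨b, a, ⟨hab, hb⟩, rfl⟩
    · rintro ⟨b, a', ⟨hab, hb⟩, rfl⟩
      exact ⟨b, hb, hab⟩
  rw [h]
  exact (((OrderClosedTopology.isClosed_le').inter
    (hs.preimage continuous_fst)).isCompact.image continuous_snd).isClosed

/-- Points that are not ordered are separated by an open up-set and an open down-set. -/
theorem exists_open_upper_lower {z z' : K} (h : ¬ z ≤ z') :
    ∃ U V : Set K, IsOpen U ∧ IsUpperSet U ∧ z ∈ U ∧ IsOpen V ∧ IsLowerSet V ∧ z' ∈ V ∧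
      Disjoint U V := by
  have hd : Disjoint (Set.Ici z) (Set.Iic z') :=
    Set.disjoint_left.2 fun a (ha : z ≤ a) (ha' : a ≤ z') => h (ha.trans ha')
  obtain ⟨O, O', hO, hO', hzO, hzO', hOO'⟩ :=
    SeparatedNhds.of_isCompact_isCompact isClosed_Ici.isCompact isClosed_Iic.isCompact hd
  refine ⟨(lowerClosure Oᶜ : Set K)ᶜ, (upperClosure O'ᶜ : Set K)ᶜ,
    (isClosed_lowerClosure_of_isClosed hO.isClosed_compl).isOpen_compl,
    (lowerClosure Oᶜ).lower.compl, ?_,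
    (isClosed_upperClosure_of_isClosed hO'.isClosed_compl).isOpen_compl,
    (upperClosure O'ᶜ).upper.compl, ?_, ?_⟩
  · rintro ⟨a, ha, hza⟩
    exact ha (hzO hza)
  · rintro ⟨a, ha, hza⟩
    exact ha (hzO' hza)
  · refine hOO'.mono ?_ ?_
    · exact fun a ha => by_contra fun h' => ha (subset_lowerClosure h')
    · exact fun a ha => by_contra fun h' => ha (subset_upperClosure h')

end Separation

/-- Only principal up-sets matter. This pointwise lifting form is the one used in all later
arguments. -/
theorem isBoundedMap_iff {A B : Type*} [Preorder A] [LE B] {f : A → B} :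
    IsBoundedMap f ↔ ∀ a b, f a ≤ b → ∃ a', a ≤ a' ∧ f a' = b := by
  constructor
  · intro h a b hab
    obtain ⟨a', ha', rfl⟩ := h (Set.Ici a) (isUpperSet_Ici a) hab ⟨a, le_refl a, rfl⟩
    exact ⟨a', ha', rfl⟩
  · rintro h U hU _ b hab ⟨a, ha, rfl⟩
    obtain ⟨a', ha', rfl⟩ := h a b hab
    exact ⟨a', hU ha' ha, rfl⟩

/-! ### Prime separation -/

namespace Spec

variable {L : Type*} [DistribLattice L] [BoundedOrder L]

theorem val_mono (s : Spec L) {a b : L} (h : a ≤ b) (ha : s.val a = true) : s.val b = true := by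
  have := s.map_sup a b
  rw [sup_eq_right.2 h, ha] at this
  simpa using this

theorem val_inf_eq_true (s : Spec L) {a b : L} :
    s.val (a ⊓ b) = true ↔ s.val a = true ∧ s.val b = true := by
  rw [s.map_inf, Bool.and_eq_true]

theorem val_sup_eq_true (s : Spec L) {a b : L} :
    s.val (a ⊔ b) = true ↔ s.val a = true ∨ s.val b = true := by
  rw [s.map_sup, Bool.or_eq_true]

open Classical in
/-- A nonempty set closed under meets and a nonempty set closed under joins such that no element
of the first is below an element of the second are separated by a point of the spectrum. -/
theorem exists_separating {G J : Set L} (hG : G.Nonempty) (hJ : J.Nonempty)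
    (hGi : ∀ a ∈ G, ∀ b ∈ G, a ⊓ b ∈ G) (hJs : ∀ a ∈ J, ∀ b ∈ J, a ⊔ b ∈ J)
    (h : ∀ a ∈ G, ∀ b ∈ J, ¬ a ≤ b) :
    ∃ s : Spec L, (∀ a ∈ G, s.val a = true) ∧ ∀ b ∈ J, ¬ s.val b = true := by
  let F : Order.PFilter L := Order.IsPFilter.toPFilter (F := {a | ∃ g ∈ G, g ≤ a}) <| by
    refine Order.IsPFilter.of_def ?_ ?_ ?_
    · exact hG.mono fun a ha => ⟨a, ha, le_rfl⟩
    · rintro a ⟨g, hg, hga⟩ b ⟨g', hg', hgb⟩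
      exact ⟨g ⊓ g', ⟨_, hGi _ hg _ hg', le_rfl⟩, inf_le_left.trans hga, inf_le_right.trans hgb⟩
    · rintro a b hab ⟨g, hg, hga⟩
      exact ⟨g, hg, hga.trans hab⟩
  let I : Order.Ideal L := Order.IsIdeal.toIdeal (I := {a | ∃ g ∈ J, a ≤ g}) <| by
    refine ⟨?_, hJ.mono fun a ha => ⟨a, ha, le_rfl⟩, ?_⟩
    · rintro a b hab ⟨g, hg, hga⟩
      exact ⟨g, hg, hab.trans hga⟩
    · rintro a ⟨g, hg, hga⟩ b ⟨g', hg', hgb⟩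
      exact ⟨g ⊔ g', ⟨_, hJs _ hg _ hg', le_rfl⟩, hga.trans le_sup_left, hgb.trans le_sup_right⟩
  have hFI : Disjoint (F : Set L) (I : Set L) := by
    refine Set.disjoint_left.2 ?_
    rintro a ⟨g, hg, hga⟩ ⟨g', hg', hga'⟩
    exact h g hg g' hg' (hga.trans hga')
  obtain ⟨M, hM, hIM, hFM⟩ := DistribLattice.prime_ideal_of_disjoint_filter_ideal hFI
  have hmem : ∀ a b, a ⊓ b ∈ M ↔ a ∈ M ∨ b ∈ M := fun a b =>
    ⟨fun hab => hM.mem_or_mem hab, fun hab => hab.elim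
      (fun h' => M.lower inf_le_left h') fun h' => M.lower inf_le_right h'⟩
  have hFM' : ∀ a ∈ F, a ∉ M := fun a ha => Set.disjoint_left.1 hFM ha
  refine ⟨⟨fun a => decide (a ∉ M), ?_, ?_, ?_, ?_⟩, ?_, ?_⟩
  · obtain ⟨g, hg⟩ := hG
    exact decide_eq_true (hFM' ⊤ ⟨g, hg, le_top⟩)
  · simp
  · intro a b
    rw [← Bool.decide_or]
    refine decide_eq_decide.2 ?_
    rw [Order.Ideal.sup_mem_iff, not_and_or]
  · intro a b
    rw [← Bool.decide_and]
    refine decide_eq_decide.2 ?_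
    rw [hmem, not_or]
  · exact fun a ha => decide_eq_true (hFM' a ⟨a, ha, le_rfl⟩)
  · intro b hb hb'
    exact of_decide_eq_true hb' (hIM ⟨b, hb, le_rfl⟩)

end Spec

/-! ### Extension of order-preserving maps to the compactification -/

namespace Up

variable {A : Type*} [Preorder A]

/-- An up-set as an element of the lattice of up-sets. -/
def of (U : Set A) (h : IsUpperSet U) : Up A := OrderDual.toDual ⟨U, h⟩

/-- The underlying set of an element of the lattice of up-sets. -/
def carrier (U : Up A) : Set A := (OrderDual.ofDual U : UpperSet A)

theorem isUpperSet_carrier (U : Up A) : IsUpperSet U.carrier := (OrderDual.ofDual U).upper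

theorem le_iff {U V : Up A} : U ≤ V ↔ U.carrier ⊆ V.carrier := Iff.rfl

theorem ext {U V : Up A} (h : U.carrier = V.carrier) : U = V :=
  OrderDual.ofDual.injective (UpperSet.ext h)

@[simp] theorem carrier_of (U : Set A) (h : IsUpperSet U) : (of U h).carrier = U := rfl

@[simp] theorem carrier_inf (U V : Up A) : (U ⊓ V).carrier = U.carrier ∩ V.carrier := rfl

@[simp] theorem carrier_sup (U V : Up A) : (U ⊔ V).carrier = U.carrier ∪ V.carrier := rfl

@[simp] theorem carrier_bot : (⊥ : Up A).carrier = ∅ := rfl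

end Up

namespace Beta

variable {A : Type*} [Preorder A]

open Classical in
/-- The prime filter of up-sets that belong to an ultrafilter. -/
noncomputable def trace (l : Ultrafilter A) : Beta A where
  val U := decide (U.carrier ∈ l)
  map_top := decide_eq_true (Filter.univ_mem : Set.univ ∈ (l : Filter A))
  map_bot := decide_eq_false (by simp)
  map_sup U V := by
    rw [← Bool.decide_or]
    exact decide_eq_decide.2 (by rw [Up.carrier_sup, Ultrafilter.union_mem_iff])
  map_inf U V := by
    rw [← Bool.decide_and]
    exact decide_eq_decide.2 (by rw [Up.carrier_inf]; exact Filter.inter_mem_iff)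

theorem trace_val {l : Ultrafilter A} {U : Up A} :
    (trace l).val U = true ↔ U.carrier ∈ l := by
  classical exact decide_eq_true_iff

theorem unit_val {a : A} {U : Up A} : (unit a).val U = true ↔ a ∈ U.carrier := by
  classical exact decide_eq_true_iff

theorem trace_pure (a : A) : trace (pure a) = unit a :=
  Spec.ext (funext fun U => Bool.eq_iff_iff.2 (by rw [trace_val, unit_val]; rfl))

theorem continuous_trace : Continuous (trace : Ultrafilter A → Beta A) := by
  refine continuous_induced_rng.2 (continuous_pi fun U => ?_)
  refine continuous_discrete_rng.2 fun b => ?_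
  have h : IsClopen {l : Ultrafilter A | U.carrier ∈ l} :=
    ⟨ultrafilter_isClosed_basic _, ultrafilter_isOpen_basic _⟩
  cases b with
  | true =>
    convert h.isOpen using 1
    ext l
    exact trace_val
  | false =>
    convert h.compl.isOpen using 1
    ext l
    exact (Bool.eq_false_iff).trans (not_congr trace_val)

/-- Prime separation in the powerset lattice: the members of `p` generate a filter that avoids the
ideal generated by the up-sets outside `p`, and a prime filter of subsets is an ultrafilter. -/
theorem surjective_trace : Function.Surjective (trace : Ultrafilter A → Beta A) := by
  intro p
  obtain ⟨s, hs, hs'⟩ := Spec.exists_separating (L := Set A)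
    (G := Up.carrier '' {U | p.val U = true}) (J := Up.carrier '' {U | ¬ p.val U = true})
    ⟨_, ⊤, p.map_top, rfl⟩ ⟨_, ⊥, by simp [p.map_bot], rfl⟩
    (by
      rintro _ ⟨U, hU, rfl⟩ _ ⟨V, hV, rfl⟩
      exact ⟨U ⊓ V, p.val_inf_eq_true.2 ⟨hU, hV⟩, rfl⟩)
    (by
      rintro _ ⟨U, hU, rfl⟩ _ ⟨V, hV, rfl⟩
      exact ⟨U ⊔ V, fun h => (p.val_sup_eq_true.1 h).elim hU hV, rfl⟩)
    (by
      rintro _ ⟨U, hU, rfl⟩ _ ⟨V, hV, rfl⟩ h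
      exact hV (p.val_mono (Up.le_iff.2 h) hU))
  let F : Filter A :=
    { sets := {a | s.val a = true}
      univ_sets := s.map_top
      sets_of_superset := fun ha hab => s.val_mono hab ha
      inter_sets := fun ha hb => s.val_inf_eq_true.2 ⟨ha, hb⟩ }
  have hF : ∀ a, aᶜ ∉ F ↔ a ∈ F := by
    intro a
    constructor
    · intro ha
      have : s.val (a ⊔ aᶜ) = true := by rw [sup_compl_eq_top]; exact s.map_top
      exact (s.val_sup_eq_true.1 this).resolve_right ha
    · intro ha ha'
      have : s.val (a ⊓ aᶜ) = true := s.val_inf_eq_true.2 ⟨ha, ha'⟩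
      rw [inf_compl_eq_bot, s.map_bot] at this
      exact Bool.false_ne_true this
  refine ⟨Ultrafilter.ofComplNotMemIff F hF, Spec.ext (funext fun U => Bool.eq_iff_iff.2 ?_)⟩
  rw [trace_val]
  constructor
  · intro h
    by_contra h'
    exact hs' _ ⟨U, h', rfl⟩ h
  · exact fun h => hs _ ⟨U, h, rfl⟩

variable {K : Type*} [TopologicalSpace K] [PartialOrder K] [CompactSpace K]
  [OrderClosedTopology K]

theorem mem_of_ultrafilter_extend_mem {B : Type*} {φ : B → K} {l : Ultrafilter B} {O : Set K} (hO : IsOpen O)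
    (h : Ultrafilter.extend φ l ∈ O) : φ ⁻¹' O ∈ l :=
  (ultrafilter_extend_eq_iff.1 (rfl : Ultrafilter.extend φ l = _)) (hO.mem_nhds h)

/-- If the limits were not ordered, an open up-set around the first and a disjoint open down-set
around the second would separate them. The preimage of the up-set is an up-set in `l`, hence in
`l'`, which also contains the preimage of the down-set. -/
theorem ultrafilter_extend_le {φ : A → K} (hφ : Monotone φ) {l l' : Ultrafilter A}
    (h : trace l ≤ trace l') : Ultrafilter.extend φ l ≤ Ultrafilter.extend φ l' := by
  by_contra hn
  obtain ⟨U, V, hU, hUu, hzU, hV, -, hzV, hUV⟩ := exists_open_upper_lower hn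
  have h1 := mem_of_ultrafilter_extend_mem hU hzU
  have h2 := mem_of_ultrafilter_extend_mem hV hzV
  have h3 : φ ⁻¹' U ∈ l' := trace_val.1 (h (Up.of _ (hUu.preimage hφ)) (trace_val.2 h1))
  have h4 := Filter.inter_mem h3 h2
  rw [← Set.preimage_inter, Set.disjoint_iff_inter_eq_empty.1 hUV, Set.preimage_empty] at h4
  exact l'.empty_notMem h4

/-- The extension of an order-preserving map to a compact ordered space. -/
noncomputable def extend (φ : A →o K) : Beta A →Co K where
  -- Any ultrafilter with trace `p` gives the same value, since `ultrafilter_extend_le` applies in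
  -- both directions.
  toFun p := Ultrafilter.extend φ (Function.surjInv surjective_trace p)
  monotone' p q h := ultrafilter_extend_le φ.monotone (by
    rwa [Function.surjInv_eq surjective_trace, Function.surjInv_eq surjective_trace])
  continuous_toFun := by
    have hq : Topology.IsQuotientMap (trace : Ultrafilter A → Beta A) :=
      Topology.IsQuotientMap.of_surjective_continuous surjective_trace continuous_trace
    refine hq.continuous_iff.2 ?_
    convert continuous_ultrafilter_extend (φ : A → K) using 1
    funext l
    exact le_antisymm
      (ultrafilter_extend_le φ.monotone (Function.surjInv_eq surjective_trace _).le)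
      (ultrafilter_extend_le φ.monotone (Function.surjInv_eq surjective_trace _).ge)

theorem extend_trace (φ : A →o K) (l : Ultrafilter A) :
    extend φ (trace l) = Ultrafilter.extend φ l :=
  le_antisymm
    (ultrafilter_extend_le φ.monotone (Function.surjInv_eq surjective_trace _).le)
    (ultrafilter_extend_le φ.monotone (Function.surjInv_eq surjective_trace _).ge)

@[simp] theorem extend_unit (φ : A →o K) (a : A) : extend φ (unit a) = φ a := by
  rw [← trace_pure, extend_trace, ultrafilter_extend_pure]

/-- This lemma and the next translate the position of the extended value into membership in the
prime filter `p`; they are the only facts about the extension used in the separation arguments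
below. -/
theorem val_of_extend_mem_upper {φ : A →o K} {p : Beta A} {O : Set K} (hO : IsOpen O)
    (hO' : IsUpperSet O) (h : extend φ p ∈ O) :
    p.val (Up.of (φ ⁻¹' O) (hO'.preimage φ.monotone)) = true := by
  obtain ⟨l, rfl⟩ := surjective_trace p
  rw [extend_trace] at h
  have h' := mem_of_ultrafilter_extend_mem hO h
  exact trace_val.2 h'

theorem not_val_of_extend_mem_lower {φ : A →o K} {p : Beta A} {O : Set K} (hO : IsOpen O)
    (hO' : IsLowerSet O) (h : extend φ p ∈ O) :
    ¬ p.val (Up.of (φ ⁻¹' Oᶜ) (hO'.compl.preimage φ.monotone)) = true := by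
  obtain ⟨l, rfl⟩ := surjective_trace p
  rw [extend_trace] at h
  intro h'
  have h4 := Filter.inter_mem (mem_of_ultrafilter_extend_mem hO h) (trace_val.1 h')
  rw [Up.carrier_of, ← Set.preimage_inter, Set.inter_compl_self, Set.preimage_empty] at h4
  exact l.empty_notMem h4

/-- Two continuous maps on the compactification that agree on points are equal. -/
theorem hom_ext {L : Type*} [TopologicalSpace L] [PartialOrder L] [T2Space L]
    {f g : Beta A →Co L} (h : ∀ a, f (unit a) = g (unit a)) (p : Beta A) :
    f p = g p := by
  obtain ⟨l, rfl⟩ := surjective_trace p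
  have : (fun l => f (trace l)) = fun l : Ultrafilter A => g (trace l) :=
    denseRange_pure.equalizer (f.continuous_toFun.comp continuous_trace)
      (g.continuous_toFun.comp continuous_trace) (funext fun a => by simp [trace_pure, h])
  exact congrFun this l

end Beta

variable {C : Type u} [Category.{v} C]

section Extension

variable {K : Cᵒᵖ ⥤ Preord.{w₁}} {S : Cᵒᵖ ⥤ KOrd.{w₂}}

/-- The extension by continuity of a natural transformation to a presheaf of compact ordered
spaces. -/
noncomputable def OrdTrans.extend (x : OrdTrans K S) : KOrdTrans (K ⋙ beta) S where
  app n := Beta.extend (x.app n)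
  naturality {n m} σ s := by
    let r : S.obj (op m) →Co S.obj (op n) := ConcreteCategory.hom (S.map σ.op)
    exact Beta.hom_ext (f := (Beta.extend (x.app n)).comp (Beta.map (K.map σ.op).hom))
      (g := r.comp (Beta.extend (x.app m))) (fun a => by
        have h : Beta.map (K.map σ.op).hom (Beta.unit a) = Beta.unit (K.map σ.op a) := rfl
        have h' : Beta.extend (x.app n) (Beta.unit (K.map σ.op a)) = x.app n (K.map σ.op a) :=
          Beta.extend_unit (x.app n) (K.map σ.op a)
        change Beta.extend (x.app n) (Beta.map (K.map σ.op).hom (Beta.unit a)) =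
          r (Beta.extend (x.app m) (Beta.unit a))
        rw [h, h', Beta.extend_unit, x.naturality]) s

theorem OrdTrans.extend_extends (x : OrdTrans K S) : x.extend.Extends x :=
  fun n p => Beta.extend_unit (x.app n) p

theorem KOrdTrans.Extends.eq {x : OrdTrans K S} {τ : KOrdTrans (K ⋙ beta) S} (h : τ.Extends x)
    (n : C) (p : Beta (K.obj (op n))) : τ.app n p = Beta.extend (x.app n) p :=
  Beta.hom_ext (f := τ.app n) (g := Beta.extend (x.app n))
    (fun a => (h n a).trans (Beta.extend_unit (x.app n) a).symm) p

/-- Every element of `K` whose type lies in the image of an open up-set `U` has, up to the order,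
a preimage whose type lies in `U`. -/
def OrdTrans.Witnessing (x : OrdTrans K S) : Prop :=
  ∀ {n m : C} (σ : n ⟶ m) (U : Set (S.obj (op m))), IsOpen U → IsUpperSet U →
    ∀ (z : K.obj (op n)) (t : S.obj (op m)), t ∈ U → S.map σ.op t = x.app n z →
      ∃ z' : K.obj (op m), x.app m z' ∈ U ∧ K.map σ.op z' ≤ z

/-- The required `q` must contain the preimages of the open up-sets around `t` and omit the
preimages along `σ` of the up-sets outside `p`. If these demands clashed for `U` and `V`, the image
of `U`, an open up-set, would have a preimage in `p`, and witnesses would place that preimage inside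
`V`. -/
theorem OrdTrans.Witnessing.isMorphism {x : OrdTrans K S} (hx : x.Witnessing)
    (hS : IsOpenPolyadic S) : x.extend.IsMorphism := by
  intro n m σ t p htp
  change Beta (K.obj (op n)) at p
  change S.map σ.op t ≤ Beta.extend (x.app n) p at htp
  obtain ⟨q, hq, hq'⟩ := Spec.exists_separating (L := Up (K.obj (op m)))
    (G := {V | ∃ (U : Set (S.obj (op m))) (_ : IsOpen U) (hU : IsUpperSet U), t ∈ U ∧
      V = Up.of (x.app m ⁻¹' U) (hU.preimage (x.app m).monotone)})
    (J := Up.comap (K.map σ.op).hom '' {V | ¬ p.val V = true})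
    ⟨_, Set.univ, isOpen_univ, isUpperSet_univ, trivial, rfl⟩ ⟨_, ⊥, by simp [p.map_bot], rfl⟩
    (by
      rintro _ ⟨U, hU, hUu, htU, rfl⟩ _ ⟨V, hV, hVu, htV, rfl⟩
      exact ⟨U ∩ V, hU.inter hV, hUu.inter hVu, ⟨htU, htV⟩, Up.ext rfl⟩)
    (by
      rintro _ ⟨U, hU, rfl⟩ _ ⟨V, hV, rfl⟩
      exact ⟨U ⊔ V, fun h => (p.val_sup_eq_true.1 h).elim hU hV, rfl⟩)
    (by
      rintro _ ⟨U, hU, hUu, htU, rfl⟩ _ ⟨V, hV, rfl⟩ h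
      obtain ⟨ho, hu⟩ := hS σ U hU hUu
      have h1 := Beta.val_of_extend_mem_upper (φ := x.app n) ho hu (hu htp ⟨t, htU, rfl⟩)
      refine hV (p.val_mono (Up.le_iff.2 ?_) h1)
      rintro z ⟨t', ht', htz⟩
      obtain ⟨z', hz', hzz'⟩ := hx σ U hU hUu z t' ht' htz
      exact V.isUpperSet_carrier hzz' (h hz'))
  refine ⟨q, ?_, ?_⟩
  · by_contra hn
    obtain ⟨U, V, hU, hUu, hzU, hV, hVl, hzV, hUV⟩ := exists_open_upper_lower hn
    refine Beta.not_val_of_extend_mem_lower (φ := x.app m) hV hVl hzV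
      (q.val_mono (Up.le_iff.2 ?_) (hq _ ⟨U, hU, hUu, hzU, rfl⟩))
    exact fun a (ha : x.app m a ∈ U) => hUV.subset_compl_right ha
  · intro V hV
    by_contra hn
    exact hq' _ ⟨V, hn, rfl⟩ hV

/-- The point `q` above `p` with value `t` is found by separation. A clash between `A` in `p` and
neighbourhoods `U`, `O` of `t` would mean that no element of `A` has its type below `U ∩ O`. But the
down-closure of `U ∩ O` is an open down-set containing the value of `p`. -/
theorem OrdTrans.bounded_extend {x : OrdTrans K S} {n : C} (hx : IsBoundedMap (x.app n))
    (hS : ∀ W : Set (S.obj (op n)), IsOpen W → IsOpen (lowerClosure W : Set (S.obj (op n)))) :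
    IsBoundedMap (x.extend.app n) := by
  have hx := isBoundedMap_iff.1 hx
  refine isBoundedMap_iff.2 fun p t hpt => ?_
  change Beta (K.obj (op n)) at p
  change Beta.extend (x.app n) p ≤ t at hpt
  obtain ⟨q, hq, hq'⟩ := Spec.exists_separating (L := Up (K.obj (op n)))
    (G := {V | ∃ (A : Up (K.obj (op n))) (U : Set (S.obj (op n))) (_ : IsOpen U)
      (hU : IsUpperSet U), p.val A = true ∧ t ∈ U ∧
      V = A ⊓ Up.of (x.app n ⁻¹' U) (hU.preimage (x.app n).monotone)})
    (J := {V | ∃ (O : Set (S.obj (op n))) (_ : IsOpen O) (hO : IsLowerSet O), t ∈ O ∧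
      V = Up.of (x.app n ⁻¹' Oᶜ) (hO.compl.preimage (x.app n).monotone)})
    ⟨_, ⊤, Set.univ, isOpen_univ, isUpperSet_univ, p.map_top, trivial, rfl⟩
    ⟨_, Set.univ, isOpen_univ, isLowerSet_univ, trivial, rfl⟩
    (by
      rintro _ ⟨A, U, hU, hUu, hA, htU, rfl⟩ _ ⟨B, V, hV, hVu, hB, htV, rfl⟩
      refine ⟨A ⊓ B, U ∩ V, hU.inter hV, hUu.inter hVu, p.val_inf_eq_true.2 ⟨hA, hB⟩,
        ⟨htU, htV⟩, ?_⟩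
      rw [inf_inf_inf_comm]
      rfl)
    (by
      rintro _ ⟨U, hU, hUl, htU, rfl⟩ _ ⟨V, hV, hVl, htV, rfl⟩
      exact ⟨U ∩ V, hU.inter hV, hUl.inter hVl, ⟨htU, htV⟩,
        Up.ext (by simp [Set.compl_inter, Set.preimage_union])⟩)
    (by
      rintro _ ⟨A, U, hU, hUu, hA, htU, rfl⟩ _ ⟨O, hO, hOl, htO, rfl⟩ h
      have hW := hS (U ∩ O) (hU.inter hO)
      refine Beta.not_val_of_extend_mem_lower (φ := x.app n) hW (lowerClosure _).lower
        ⟨t, ⟨htU, htO⟩, hpt⟩ (p.val_mono (Up.le_iff.2 ?_) hA)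
      rintro z hz ⟨t', ⟨htU', htO'⟩, hzt'⟩
      obtain ⟨z', hz', rfl⟩ := hx z t' hzt'
      exact h ⟨A.isUpperSet_carrier hz' hz, htU'⟩ htO')
  refine ⟨q, fun V hV => hq _ ⟨V, Set.univ, isOpen_univ, isUpperSet_univ, hV, trivial, ?_⟩, ?_⟩
  · exact (inf_top_eq V).symm
  · refine le_antisymm ?_ ?_
    · by_contra hn
      obtain ⟨U, V, hU, hUu, hzU, hV, hVl, hzV, hUV⟩ := exists_open_upper_lower hn
      refine hq' _ ⟨V, hV, hVl, hzV, rfl⟩ (q.val_mono (Up.le_iff.2 ?_)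
        (Beta.val_of_extend_mem_upper (φ := x.app n) hU hUu hzU))
      exact fun a (ha : x.app n a ∈ U) => hUV.subset_compl_right ha
    · by_contra hn
      obtain ⟨U, V, hU, hUu, hzU, hV, hVl, hzV, hUV⟩ := exists_open_upper_lower hn
      refine Beta.not_val_of_extend_mem_lower (φ := x.app n) hV hVl hzV
        (q.val_mono (Up.le_iff.2 ?_) (hq _ ⟨⊤, U, hU, hUu, p.map_top, hzU, rfl⟩))
      exact fun a ha => hUV.subset_compl_right (show x.app n a ∈ U from ha.2)

/-- Dual to the existential case: the down-closure of the image of an open down-set around `t` is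
open and contains the value of `p`, so it meets the types of every up-set in `p`. -/
theorem OrdTrans.back_extend {x : OrdTrans K S} {n m : C} {σ : n ⟶ m}
    (hx : Interpolation (K.map σ.op) (x.app m) (x.app n) (S.map σ.op))
    (hS : ∀ U : Set (S.obj (op m)), IsOpen U → IsLowerSet U →
      IsOpen (lowerClosure (S.map σ.op '' U) : Set (S.obj (op n)))) :
    Interpolation ((K ⋙ beta).map σ.op) (x.extend.app m) (x.extend.app n) (S.map σ.op) := by
  intro p t hpt
  change Beta (K.obj (op n)) at p
  change Beta.extend (x.app n) p ≤ S.map σ.op t at hpt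
  obtain ⟨q, hq, hq'⟩ := Spec.exists_separating (L := Up (K.obj (op m)))
    (G := Up.comap (K.map σ.op).hom '' {V | p.val V = true})
    (J := {V | ∃ (O : Set (S.obj (op m))) (_ : IsOpen O) (hO : IsLowerSet O), t ∈ O ∧
      V = Up.of (x.app m ⁻¹' Oᶜ) (hO.compl.preimage (x.app m).monotone)})
    ⟨_, ⊤, p.map_top, rfl⟩
    ⟨_, Set.univ, isOpen_univ, isLowerSet_univ, trivial, rfl⟩
    (by
      rintro _ ⟨U, hU, rfl⟩ _ ⟨V, hV, rfl⟩
      exact ⟨U ⊓ V, p.val_inf_eq_true.2 ⟨hU, hV⟩, rfl⟩)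
    (by
      rintro _ ⟨U, hU, hUl, htU, rfl⟩ _ ⟨V, hV, hVl, htV, rfl⟩
      exact ⟨U ∩ V, hU.inter hV, hUl.inter hVl, ⟨htU, htV⟩,
        Up.ext (by simp [Set.compl_inter, Set.preimage_union])⟩)
    (by
      rintro _ ⟨A, hA, rfl⟩ _ ⟨O, hO, hOl, htO, rfl⟩ h
      refine Beta.not_val_of_extend_mem_lower (φ := x.app n) (hS O hO hOl)
        (lowerClosure _).lower ⟨_, ⟨t, htO, rfl⟩, hpt⟩ (p.val_mono (Up.le_iff.2 ?_) hA)
      rintro z hz ⟨_, ⟨t', ht', rfl⟩, hzt'⟩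
      obtain ⟨z', hz', hzt''⟩ := hx z t' hzt'
      exact h (show z' ∈ (Up.comap (K.map σ.op).hom A).carrier from
        A.isUpperSet_carrier hz' hz) (hOl hzt'' ht'))
  refine ⟨q, fun V hV => hq _ ⟨V, hV, rfl⟩, ?_⟩
  by_contra hn
  obtain ⟨U, V, hU, hUu, hzU, hV, hVl, hzV, hUV⟩ := exists_open_upper_lower hn
  refine hq' _ ⟨V, hV, hVl, hzV, rfl⟩ (q.val_mono (Up.le_iff.2 ?_)
    (Beta.val_of_extend_mem_upper (φ := x.app m) hU hUu hzU))
  exact fun a (ha : x.app m a ∈ U) => hUV.subset_compl_right ha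

/-- In an extension that is a morphism, points of `K` have witnesses. -/
theorem KOrdTrans.Extends.witnessing {x : OrdTrans K S} {τ : KOrdTrans (K ⋙ beta) S}
    (h : τ.Extends x) (hτ : τ.IsMorphism) : x.Witnessing := by
  intro n m σ U hU hUu z t htU htz
  have hz : S.map σ.op t ≤ τ.app n (Beta.unit z : Beta (K.obj (op n))) := by
    rw [h n z, htz]
  obtain ⟨q, hq, hqz⟩ := hτ σ t (Beta.unit z : Beta (K.obj (op n))) hz
  change Beta (K.obj (op m)) at q
  rw [h.eq] at hq
  have h1 := Beta.val_of_extend_mem_upper (φ := x.app m) hU hUu (hUu hq htU)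
  by_contra hn
  push Not at hn
  -- The largest up-set that omits `z`: if no witness lay over an element below `z`, then `q` would
  -- contain the preimage of `V`, and `V` would contain `z`.
  let V : Up (K.obj (op n)) := Up.of {y | ¬ y ≤ z} fun a b hab ha hb => ha (hab.trans hb)
  have h2 : q.val (Up.comap (K.map σ.op).hom V) = true := by
    refine q.val_mono (Up.le_iff.2 ?_) h1
    exact fun z' (hz' : x.app m z' ∈ U) => hn z' hz'
  exact Beta.unit_val.1 (hqz V h2) le_rfl

end Extension

namespace TypeOver

variable {X : Cᵒᵖ ⥤ Type w₁} {S : Cᵒᵖ ⥤ KOrd.{w₂}}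

theorem isStructure_of_witnesses {x : TypeOver X S} (hS : IsOpenPolyadic S)
    (h : ∀ {n m : C} (σ : n ⟶ m) (p : X.obj (op n)) (t : S.obj (op m)),
      S.map σ.op t = x.app n p → ∃ p' : X.obj (op m), X.map σ.op p' = p ∧ t ≤ x.app m p') :
    x.IsStructure := by
  refine ⟨x.toOrdTrans.extend, x.toOrdTrans.extend_extends,
    OrdTrans.Witnessing.isMorphism ?_ hS⟩
  intro n m σ U hU hUu z t ht htz
  obtain ⟨p', hp', htp'⟩ := h σ z t htz
  exact ⟨p', hUu htp' ht, hp'⟩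

/-- On a presheaf of sets the order is equality, so the witness lies exactly over `p`. -/
theorem IsStructure.exists_witness {x : TypeOver X S} (hx : x.IsStructure) {n m : C}
    (σ : n ⟶ m) {U : Set (S.obj (op m))} (hU : IsOpen U) (hUu : IsUpperSet U)
    (p : X.obj (op n)) {t : S.obj (op m)} (ht : t ∈ U) (htp : S.map σ.op t = x.app n p) :
    ∃ p' : X.obj (op m), X.map σ.op p' = p ∧ x.app m p' ∈ U := by
  obtain ⟨τ, hτ, hτm⟩ := hx
  obtain ⟨p', hp', hpp'⟩ := hτ.witnessing hτm σ U hU hUu p t ht htp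
  exact ⟨p', hpp', hp'⟩

end TypeOver

/-! ### Types on presheaves -/

namespace KOrd

theorem continuous_map {A B : KOrd.{w}} (f : A ⟶ B) : Continuous (f : A → B) :=
  (ConcreteCategory.hom f).continuous_toFun

theorem monotone_map {A B : KOrd.{w}} (f : A ⟶ B) : Monotone (f : A → B) :=
  (ConcreteCategory.hom f).monotone'

theorem map_comp_apply (S : Cᵒᵖ ⥤ KOrd.{w}) {n m k : C} (a : n ⟶ m) (b : m ⟶ k)
    (s : S.obj (op k)) : S.map (a ≫ b).op s = S.map a.op (S.map b.op s) := by
  rw [op_comp, S.map_comp]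
  rfl

theorem map_id_apply (S : Cᵒᵖ ⥤ KOrd.{w}) {n : C} (s : S.obj (op n)) :
    S.map (𝟙 n).op s = s := by
  rw [op_id, S.map_id]
  rfl

/-- The underlying presheaf of sets of a presheaf of compact ordered spaces. -/
def points (S : Cᵒᵖ ⥤ KOrd.{w}) : Cᵒᵖ ⥤ Type w where
  obj n := S.obj n
  map f := TypeCat.ofHom (S.map f)
  map_id n := by
    rw [S.map_id]
    rfl
  map_comp f g := by
    rw [S.map_comp]
    rfl

end KOrd

theorem presheaf_map_comp_apply (X : Cᵒᵖ ⥤ Type w) {n m k : C} (a : n ⟶ m) (b : m ⟶ k)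
    (p : X.obj (op k)) : X.map (a ≫ b).op p = X.map a.op (X.map b.op p) := by
  rw [op_comp, X.map_comp]
  rfl

theorem presheaf_map_id_apply (X : Cᵒᵖ ⥤ Type w) {n : C} (p : X.obj (op n)) :
    X.map (𝟙 n).op p = p := by
  rw [op_id, X.map_id]
  rfl

theorem presheaf_hom_naturality {X Y : Cᵒᵖ ⥤ Type w} (h : X ⟶ Y) {n m : C} (a : n ⟶ m)
    (p : X.obj (op m)) :
    h.app (op n) (X.map a.op p) = Y.map a.op (h.app (op m) p) :=
  NatTrans.naturality_apply h a.op p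

namespace TypeOver

variable {X Y : Cᵒᵖ ⥤ Type w₁} {S P : Cᵒᵖ ⥤ KOrd.{w₂}}

theorem app_injective : Function.Injective (app : TypeOver X S → _) := by
  rintro ⟨a, ha⟩ ⟨b, hb⟩ h
  cases h
  rfl

instance : PartialOrder (TypeOver X S) where
  le x y := ∀ n p, x.app n p ≤ y.app n p
  le_refl _ _ _ := le_rfl
  le_trans _ _ _ h h' n p := (h n p).trans (h' n p)
  le_antisymm _ _ h h' := app_injective (funext fun n => funext fun p => (h n p).antisymm (h' n p))

/-- Restriction of types along a map of presheaves. -/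
def comap (h : X ⟶ Y) (y : TypeOver Y S) : TypeOver X S where
  app n p := y.app n (h.app (op n) p)
  naturality σ p := by rw [presheaf_hom_naturality, y.naturality]

/-- Image of types under a transformation of presheaves of compact ordered spaces. -/
def map (f : KOrdTrans S P) (x : TypeOver X S) : TypeOver X P where
  app n p := f.app n (x.app n p)
  naturality σ p := by rw [x.naturality, f.naturality]

@[simp] theorem comap_app (h : X ⟶ Y) (y : TypeOver Y S) (n : C) (p : X.obj (op n)) :
    (y.comap h).app n p = y.app n (h.app (op n) p) := rfl

theorem comap_mono (h : X ⟶ Y) {y y' : TypeOver Y S} (hy : y ≤ y') : y.comap h ≤ y'.comap h :=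
  fun n _ => hy n _

theorem map_mono (f : KOrdTrans S P) {x x' : TypeOver X S} (hx : x ≤ x') : x.map f ≤ x'.map f :=
  fun n _ => (f.app n).monotone' (hx n _)

theorem comap_map (h : X ⟶ Y) (f : KOrdTrans S P) (y : TypeOver Y S) :
    (y.map f).comap h = (y.comap h).map f := rfl

theorem comap_comp {Z : Cᵒᵖ ⥤ Type w₁} (h : X ⟶ Y) (h' : Y ⟶ Z) (z : TypeOver Z S) :
    z.comap (h ≫ h') = (z.comap h').comap h := rfl

/-- A map to the underlying presheaf of sets as a type. -/
def ofHom {X : Cᵒᵖ ⥤ Type w₂} (x : X ⟶ KOrd.points S) : TypeOver X S where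
  app n p := x.app (op n) p
  naturality σ p := presheaf_hom_naturality x σ p

/-- A type as a map to the underlying presheaf of sets. -/
def toHom {X : Cᵒᵖ ⥤ Type w₂} (x : TypeOver X S) : X ⟶ KOrd.points S where
  app n := TypeCat.ofHom fun p => x.app n.unop p
  naturality n m σ := by
    ext p
    exact x.naturality σ.unop p

end TypeOver

/-! ### Directed presentations of ind-objects -/

/-- A presentation of a presheaf as a directed colimit of representables. -/
structure DirectedPresentation (X : Cᵒᵖ ⥤ Type v) where
  J : Type v
  [order : PartialOrder J]
  [directed : IsDirectedOrder J]
  [nonempty : Nonempty J]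
  D : J ⥤ C
  ι : D ⋙ yoneda ⟶ (Functor.const J).obj X
  isColimit : IsColimit (Cocone.mk X ι)

attribute [instance] DirectedPresentation.order DirectedPresentation.directed
  DirectedPresentation.nonempty

theorem exists_directedPresentation {X : Cᵒᵖ ⥤ Type v} (hX : IsIndObject X) :
    Nonempty (DirectedPresentation X) := by
  obtain ⟨P⟩ := hX.nonempty_presentation
  obtain ⟨J, _, _, _, F, _⟩ := IsFiltered.exists_directed P.I
  have : IsDirectedOrder J := inferInstance
  exact ⟨{ J := J, D := F ⋙ P.F, ι := Functor.whiskerLeft F P.ι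
           isColimit := (Functor.Final.isColimitWhiskerEquiv F _).symm P.isColimit }⟩

namespace DirectedPresentation

variable {X : Cᵒᵖ ⥤ Type v} (R : DirectedPresentation X)

/-- The generic points. -/
def pt (j : R.J) : X.obj (op (R.D.obj j)) := (R.ι.app j).app (op (R.D.obj j)) (𝟙 (R.D.obj j))

theorem ι_app_apply (j : R.J) {n : C} (a : n ⟶ R.D.obj j) :
    (R.ι.app j).app (op n) a = X.map a.op (R.pt j) := by
  have h := NatTrans.naturality_apply (R.ι.app j) a.op (𝟙 (R.D.obj j))
  have h' : (yoneda.obj (R.D.obj j)).map a.op (𝟙 (R.D.obj j)) = a := Category.comp_id a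
  exact (congrArg ((R.ι.app j).app (op n)) h').symm.trans h

theorem map_pt {j j' : R.J} (h : j ⟶ j') : X.map (R.D.map h).op (R.pt j') = R.pt j := by
  rw [← ι_app_apply]
  have h1 := congrArg (fun f => f.app (op (R.D.obj j)) (𝟙 (R.D.obj j))) (R.ι.naturality h)
  have h' : (yoneda.map (R.D.map h)).app (op (R.D.obj j)) (𝟙 (R.D.obj j)) = R.D.map h :=
    Category.id_comp _
  exact (congrArg ((R.ι.app j').app (op (R.D.obj j))) h').symm.trans h1

theorem exists_rep {n : C} (p : X.obj (op n)) :
    ∃ (j : R.J) (a : n ⟶ R.D.obj j), X.map a.op (R.pt j) = p := by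
  obtain ⟨j, a, ha⟩ := Types.jointly_surjective _
    (isColimitOfPreserves ((evaluation _ _).obj (op n)) R.isColimit) p
  exact ⟨j, a, (R.ι_app_apply j a).symm.trans ha⟩

theorem exists_eq {n : C} {j : R.J} (a b : n ⟶ R.D.obj j)
    (h : X.map a.op (R.pt j) = X.map b.op (R.pt j)) :
    ∃ (j' : R.J) (g : j ⟶ j'), a ≫ R.D.map g = b ≫ R.D.map g := by
  have hc := isColimitOfPreserves ((evaluation _ _).obj (op n)) R.isColimit
  rw [← ι_app_apply, ← ι_app_apply] at h
  obtain ⟨j', g, hg⟩ := (Types.FilteredColimit.isColimit_eq_iff' hc a b).1 h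
  exact ⟨j', g, hg⟩

/-- The Yoneda lemma identifies a compatible family of points of `Y` with a cocone under the
representables. -/
theorem exists_glue {Y : Cᵒᵖ ⥤ Type v} (y : ∀ j, Y.obj (op (R.D.obj j)))
    (hy : ∀ {j j'} (g : j ⟶ j'), Y.map (R.D.map g).op (y j') = y j) :
    ∃ h : X ⟶ Y, ∀ j, h.app (op (R.D.obj j)) (R.pt j) = y j := by
  let c : Cocone (R.D ⋙ yoneda) :=
    { pt := Y
      ι := { app := fun j => yonedaEquiv.symm (y j)
             naturality := fun j j' g => by
              have h := yonedaEquiv_symm_map (R.D.map g).op (y j')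
              rw [hy g] at h
              exact h.symm.trans (Category.comp_id _).symm } }
  refine ⟨R.isColimit.desc c, fun j => ?_⟩
  have h := congrArg (fun f => f.app (op (R.D.obj j)) (𝟙 (R.D.obj j))) (R.isColimit.fac c j)
  refine Eq.trans h ?_
  exact yonedaEquiv.apply_symm_apply (y j)

/-- Compactness: a compatible system of nonempty closed sets of types is realized by a type on the
colimit. -/
theorem exists_type {S : Cᵒᵖ ⥤ KOrd.{v}} (V : ∀ j, Set (S.obj (op (R.D.obj j))))
    (hc : ∀ j, IsClosed (V j)) (hn : ∀ j, (V j).Nonempty)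
    (hV : ∀ {j j'} (g : j ⟶ j'), ∀ s ∈ V j', S.map (R.D.map g).op s ∈ V j) :
    ∃ x : TypeOver X S, ∀ j, x.app _ (R.pt j) ∈ V j := by
  classical
  -- The families that satisfy the condition at stage `j` and are compatible below `j`. These sets
  -- decrease as `j` grows, and a family lying in all of them is a type.
  let W : R.J → Set (∀ j, S.obj (op (R.D.obj j))) := fun j =>
    {s | s j ∈ V j} ∩ ⋂ i, ⋂ h : i ≤ j, {s | S.map (R.D.map (homOfLE h)).op (s j) = s i}
  have mem_W : ∀ {j s}, s ∈ W j ↔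
      s j ∈ V j ∧ ∀ i (h : i ≤ j), S.map (R.D.map (homOfLE h)).op (s j) = s i := by
    intro j s
    simp only [W, Set.mem_inter_iff, Set.mem_ofPred_eq, Set.mem_iInter]
  have hWc : ∀ j, IsClosed (W j) := fun j =>
    ((hc j).preimage (continuous_apply j)).inter (isClosed_iInter fun i => isClosed_iInter fun h =>
      isClosed_eq ((KOrd.continuous_map (S.map (R.D.map (homOfLE h)).op)).comp
        (continuous_apply j)) (continuous_apply i))
  have hW : (⋂ j, W j).Nonempty := by
    refine IsCompact.nonempty_iInter_of_directed_nonempty_isCompact_isClosed W ?_ ?_ ?_ ?_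
    · intro j j'
      obtain ⟨k, hk, hk'⟩ := exists_ge_ge j j'
      have key : ∀ i, i ≤ k → W k ⊆ W i := by
        intro i hi s hs
        rw [mem_W] at hs ⊢
        refine ⟨?_, fun l hl => ?_⟩
        · rw [← hs.2 i hi]
          exact hV _ _ hs.1
        · rw [← hs.2 i hi, ← hs.2 l (hl.trans hi), ← KOrd.map_comp_apply, ← R.D.map_comp]
          rfl
      exact ⟨k, key j hk, key j' hk'⟩
    · intro j
      obtain ⟨s, hs⟩ := hn j
      -- Membership in `W j` constrains only the stages below `j`; elsewhere any value will do.
      refine ⟨fun i => if h : i ≤ j then S.map (R.D.map (homOfLE h)).op s else (hn i).some,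
        mem_W.2 ⟨?_, ?_⟩⟩
      · simp only [le_refl, dif_pos]
        exact hV _ _ hs
      · intro i hi
        simp only [le_refl, dif_pos, hi]
        rw [← KOrd.map_comp_apply, ← R.D.map_comp]
        rfl
    · exact fun j => (hWc j).isCompact
    · exact hWc
  obtain ⟨s, hs⟩ := hW
  replace hs := fun j => mem_W.1 (Set.mem_iInter.1 hs j)
  obtain ⟨x, hx⟩ := R.exists_glue (Y := KOrd.points S) s
    (fun {j j'} g => (hs j').2 j (leOfHom g))
  refine ⟨TypeOver.ofHom x, fun j => ?_⟩
  have h := hx j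
  change x.app _ _ ∈ V j
  rw [h]
  exact (hs j).1

theorem type_le_of_pt {S : Cᵒᵖ ⥤ KOrd.{w}} {x y : TypeOver X S}
    (h : ∀ j, x.app _ (R.pt j) ≤ y.app _ (R.pt j)) : x ≤ y := by
  intro n p
  obtain ⟨j, a, rfl⟩ := R.exists_rep p
  rw [x.naturality, y.naturality]
  exact KOrd.monotone_map _ (h j)

theorem map_type_pt {S : Cᵒᵖ ⥤ KOrd.{w}} (x : TypeOver X S) {j j' : R.J} (g : j ⟶ j') :
    S.map (R.D.map g).op (x.app _ (R.pt j')) = x.app _ (R.pt j) := by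
  rw [← x.naturality, map_pt]

end DirectedPresentation

theorem KOrdTrans.continuous_app {S : Cᵒᵖ ⥤ KOrd.{w₁}} {T : Cᵒᵖ ⥤ KOrd.{w₂}} (f : KOrdTrans S T)
    (n : C) : Continuous (f.app n) := (f.app n).continuous_toFun

/-! ### Types on an ind-object -/

namespace TypeOver

variable {X Y : Cᵒᵖ ⥤ Type v} {S P : Cᵒᵖ ⥤ KOrd.{v}}

/-- Pointwise bounded transformations are bounded on types. -/
theorem exists_map_eq (hX : IsIndObject X) {f : KOrdTrans S P}
    (hf : ∀ n, IsBoundedMap (f.app n)) {s : TypeOver X S} {c : TypeOver X P} (h : s.map f ≤ c) :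
    ∃ s', s ≤ s' ∧ s'.map f = c := by
  obtain ⟨R⟩ := exists_directedPresentation hX
  obtain ⟨x, hx⟩ := R.exists_type (S := S)
    (fun j => {t | s.app _ (R.pt j) ≤ t} ∩ {t | f.app _ t = c.app _ (R.pt j)})
    (fun j => isClosed_Ici.inter (isClosed_eq (f.continuous_app _) continuous_const))
    (fun j => isBoundedMap_iff.1 (hf _) _ _ (h _ (R.pt j)))
    (by
      rintro j j' g t ⟨h1 : _ ≤ _, h2 : _ = _⟩
      constructor
      · change _ ≤ _
        rw [← R.map_type_pt s g]
        exact KOrd.monotone_map _ h1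
      · change _ = _
        rw [f.naturality, h2, R.map_type_pt])
  exact ⟨x, R.type_le_of_pt fun j => (hx j).1,
    le_antisymm (R.type_le_of_pt fun j => (hx j).2.le) (R.type_le_of_pt fun j => (hx j).2.ge)⟩

/-- Evaluation of types at a point is bounded. -/
theorem exists_app_eq (hX : IsIndObject X) (hS : IsPolyadic S) (x : TypeOver X S) {n : C}
    (p : X.obj (op n)) {t : S.obj (op n)} (h : x.app n p ≤ t) :
    ∃ x', x ≤ x' ∧ x'.app n p = t := by
  obtain ⟨R⟩ := exists_directedPresentation hX
  obtain ⟨i, a, rfl⟩ := R.exists_rep p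
  obtain ⟨y, hy⟩ := R.exists_type (S := S)
    (fun j => {s | x.app _ (R.pt j) ≤ s} ∩
      ⋂ g : i ⟶ j, {s | S.map (a ≫ R.D.map g).op s = t})
    (fun j => isClosed_Ici.inter (isClosed_iInter fun g =>
      isClosed_eq (KOrd.continuous_map _) continuous_const))
    (by
      intro j
      -- The exact value `t` is demanded only at the stages above `i`, where `p` is defined;
      -- elsewhere the intersection is vacuous.
      by_cases hij : i ≤ j
      · have h' : S.map (a ≫ R.D.map (homOfLE hij)).op (x.app _ (R.pt j)) ≤ t := by
          rwa [← x.naturality, presheaf_map_comp_apply, R.map_pt]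
        obtain ⟨s, hs, hs'⟩ := isBoundedMap_iff.1 (hS.bounded _) _ _ h'
        exact ⟨s, hs, Set.mem_iInter.2 fun g => hs'⟩
      · exact ⟨_, (le_refl _ : x.app _ (R.pt j) ≤ _),
          Set.mem_iInter.2 fun g => absurd (leOfHom g) hij⟩)
    (by
      rintro j j' g s ⟨h1 : _ ≤ _, h2⟩
      constructor
      · change _ ≤ _
        rw [← R.map_type_pt x g]
        exact KOrd.monotone_map _ h1
      · refine Set.mem_iInter.2 fun g' => ?_
        have h3 := Set.mem_iInter.1 h2 (g' ≫ g)
        change S.map _ s = t at h3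
        change S.map _ (S.map _ s) = t
        rw [← KOrd.map_comp_apply, Category.assoc, ← R.D.map_comp, h3])
  refine ⟨y, R.type_le_of_pt fun j => (hy j).1, ?_⟩
  have h3 : S.map (a ≫ R.D.map (𝟙 i)).op (y.app _ (R.pt i)) = t :=
    Set.mem_iInter.1 (hy i).2 (𝟙 i)
  rwa [R.D.map_id, Category.comp_id, ← y.naturality] at h3

/-- A type that is maximal among the types with the same image. -/
def IsMaximalOver (f : KOrdTrans S P) (s : TypeOver X S) : Prop :=
  ∀ s', s ≤ s' → s'.map f = s.map f → s' = s

/-- Zorn's lemma. A chain has an upper bound with the same image: at each stage the conditions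
coming from its members form a directed family of nonempty closed sets. -/
theorem exists_isMaximalOver (hX : IsIndObject X) (f : KOrdTrans S P) (s : TypeOver X S) :
    ∃ s', s ≤ s' ∧ s'.map f = s.map f ∧ s'.IsMaximalOver f := by
  obtain ⟨R⟩ := exists_directedPresentation hX
  obtain ⟨m, hsm, hm⟩ := zorn_le_nonempty₀ {s' : TypeOver X S | s'.map f = s.map f} (by
    intro c hc hch y hy
    obtain ⟨x, hx⟩ := R.exists_type (S := S)
      (fun j => ⋂ z : c, {t | z.1.app _ (R.pt j) ≤ t} ∩ {t | f.app _ t = f.app _ (s.app _ (R.pt j))})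
      (fun j => isClosed_iInter fun z =>
        isClosed_Ici.inter (isClosed_eq (f.continuous_app _) continuous_const))
      (by
        intro j
        have : Nonempty c := ⟨⟨y, hy⟩⟩
        refine IsCompact.nonempty_iInter_of_directed_nonempty_isCompact_isClosed _ ?_ ?_ ?_ ?_
        · intro z z'
          rcases hch.total z.2 z'.2 with h | h
          · exact ⟨z', fun t ht => ⟨(h _ _).trans ht.1, ht.2⟩, subset_rfl⟩
          · exact ⟨z, subset_rfl, fun t ht => ⟨(h _ _).trans ht.1, ht.2⟩⟩
        · intro z
          have h1 : z.1.map f = s.map f := hc z.2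
          exact ⟨z.1.app _ (R.pt j), le_refl (z.1.app _ (R.pt j)),
            congrArg (fun q : TypeOver X P => q.app _ (R.pt j)) h1⟩
        · exact fun z => (isClosed_Ici.inter
            (isClosed_eq (f.continuous_app _) continuous_const)).isCompact
        · exact fun z => isClosed_Ici.inter (isClosed_eq (f.continuous_app _) continuous_const))
      (by
        intro j j' g t ht
        refine Set.mem_iInter.2 fun z => ?_
        obtain ⟨h1 : _ ≤ _, h2 : _ = _⟩ := Set.mem_iInter.1 ht z
        constructor
        · change _ ≤ _
          rw [← R.map_type_pt z.1 g]
          exact KOrd.monotone_map _ h1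
        · change _ = _
          rw [f.naturality, h2, ← f.naturality, R.map_type_pt])
    have hx' : ∀ (z : c) j, z.1.app _ (R.pt j) ≤ x.app _ (R.pt j) ∧
        f.app _ (x.app _ (R.pt j)) = f.app _ (s.app _ (R.pt j)) :=
      fun z j => Set.mem_iInter.1 (hx j) z
    refine ⟨x, le_antisymm (R.type_le_of_pt fun j => (hx' ⟨y, hy⟩ j).2.le)
      (R.type_le_of_pt fun j => (hx' ⟨y, hy⟩ j).2.ge), fun z hz => ?_⟩
    exact R.type_le_of_pt fun j => (hx' ⟨z, hz⟩ j).1) s rfl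
  have hms : m.map f = s.map f := hm.prop
  exact ⟨m, hsm, hms, fun s' h h' => le_antisymm (hm.le_of_ge (h'.trans hms) h) h⟩

end TypeOver

/-! ### Presentations of maps of ind-objects -/

/-- A presentation of a map of presheaves as a directed colimit of maps of representables. -/
structure HomPresentation {X Y : Cᵒᵖ ⥤ Type v} (h : X ⟶ Y) where
  target : DirectedPresentation Y
  E : target.J ⥤ C
  α : E ⟶ target.D
  pt : ∀ k, X.obj (op (E.obj k))
  map_pt : ∀ {k k' : target.J} (g : k ⟶ k'), X.map (E.map g).op (pt k') = pt k
  hom_pt : ∀ k, h.app _ (pt k) = Y.map (α.app k).op (target.pt k)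
  exists_rep : ∀ {n : C} (p : X.obj (op n)), ∃ (k : target.J) (a : n ⟶ E.obj k),
    X.map a.op (pt k) = p

namespace HomPresentation

variable {X Y : Cᵒᵖ ⥤ Type v} {h : X ⟶ Y} (R : HomPresentation h) {S P : Cᵒᵖ ⥤ KOrd.{v}}

theorem map_type_pt {S : Cᵒᵖ ⥤ KOrd.{w}} (x : TypeOver X S) {k k' : R.target.J} (g : k ⟶ k') :
    S.map (R.E.map g).op (x.app _ (R.pt k')) = x.app _ (R.pt k) := by
  rw [← x.naturality, map_pt]

theorem type_le_of_pt {S : Cᵒᵖ ⥤ KOrd.{w}} {x y : TypeOver X S}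
    (h : ∀ k, x.app _ (R.pt k) ≤ y.app _ (R.pt k)) : x ≤ y := by
  intro n p
  obtain ⟨j, a, rfl⟩ := R.exists_rep p
  rw [x.naturality, y.naturality]
  exact KOrd.monotone_map _ (h j)

theorem comap_app_pt {S : Cᵒᵖ ⥤ KOrd.{w}} (y : TypeOver Y S) (k : R.target.J) :
    (y.comap h).app _ (R.pt k) = S.map (R.α.app k).op (y.app _ (R.target.pt k)) := by
  rw [TypeOver.comap_app, hom_pt, y.naturality]

theorem map_map_app (S : Cᵒᵖ ⥤ KOrd.{w}) {k k' : R.target.J} (g : k ⟶ k')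
    (s : S.obj (op (R.target.D.obj k'))) :
    S.map (R.α.app k).op (S.map (R.target.D.map g).op s) =
      S.map (R.E.map g).op (S.map (R.α.app k').op s) := by
  rw [← KOrd.map_comp_apply, ← KOrd.map_comp_apply, R.α.naturality]

include R

/-- Restriction of types is bounded. -/
theorem exists_comap_eq (hS : IsPolyadic S) {y : TypeOver Y S} {x : TypeOver X S}
    (hxy : y.comap h ≤ x) : ∃ y', y ≤ y' ∧ y'.comap h = x := by
  obtain ⟨y', hy'⟩ := R.target.exists_type (S := S)
    (fun k => {s | y.app _ (R.target.pt k) ≤ s} ∩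
      {s | S.map (R.α.app k).op s = x.app _ (R.pt k)})
    (fun k => isClosed_Ici.inter (isClosed_eq (KOrd.continuous_map _) continuous_const))
    (fun k => isBoundedMap_iff.1 (hS.bounded _) _ _ (by
      rw [← comap_app_pt]
      exact hxy _ _))
    (by
      rintro j j' g t ⟨h1 : _ ≤ _, h2 : _ = _⟩
      constructor
      · change _ ≤ _
        rw [← R.target.map_type_pt y g]
        exact KOrd.monotone_map _ h1
      · change _ = _
        rw [map_map_app, h2, map_type_pt])
  exact ⟨y', R.target.type_le_of_pt fun j => (hy' j).1,
    le_antisymm (R.type_le_of_pt fun j => (R.comap_app_pt y' j).trans_le (hy' j).2.le)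
      (R.type_le_of_pt fun j => (hy' j).2.ge.trans_eq (R.comap_app_pt y' j).symm)⟩

/-- Morphisms of polyadic spaces satisfy the interpolation property on types. -/
theorem exists_forth {f : KOrdTrans S P} (hf : f.IsMorphism) {c : TypeOver Y P}
    {s : TypeOver X S} (hcs : c.comap h ≤ s.map f) :
    ∃ s' : TypeOver Y S, c ≤ s'.map f ∧ s'.comap h ≤ s := by
  obtain ⟨y', hy'⟩ := R.target.exists_type (S := S)
    (fun k => {t | c.app _ (R.target.pt k) ≤ f.app _ t} ∩
      {t | S.map (R.α.app k).op t ≤ s.app _ (R.pt k)})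
    (fun k => (isClosed_le continuous_const (f.continuous_app _)).inter
      (isClosed_le (KOrd.continuous_map _) continuous_const))
    (fun k => hf (R.α.app k) _ _ (by
      rw [← comap_app_pt]
      exact hcs _ _))
    (by
      rintro j j' g t ⟨h1 : _ ≤ _, h2 : _ ≤ _⟩
      constructor
      · change _ ≤ _
        rw [f.naturality, ← R.target.map_type_pt c g]
        exact KOrd.monotone_map _ h1
      · change _ ≤ _
        rw [map_map_app, ← R.map_type_pt s g]
        exact KOrd.monotone_map _ h2)
  exact ⟨y', R.target.type_le_of_pt fun j => (hy' j).1,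
    R.type_le_of_pt fun j => (R.comap_app_pt y' j).trans_le (hy' j).2⟩

/-- Intuitionistic morphisms satisfy the reverse interpolation property on types. -/
theorem exists_back {f : KOrdTrans S P} (hf : f.IsIntuitionistic) {c : TypeOver Y P}
    {s : TypeOver X S} (hsc : s.map f ≤ c.comap h) :
    ∃ s' : TypeOver Y S, s ≤ s'.comap h ∧ s'.map f ≤ c := by
  obtain ⟨y', hy'⟩ := R.target.exists_type (S := S)
    (fun k => {t | s.app _ (R.pt k) ≤ S.map (R.α.app k).op t} ∩
      {t | f.app _ t ≤ c.app _ (R.target.pt k)})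
    (fun k => (isClosed_le continuous_const (KOrd.continuous_map _)).inter
      (isClosed_le (f.continuous_app _) continuous_const))
    (fun k => hf.back (R.α.app k) _ _ (by
      rw [← comap_app_pt]
      exact hsc _ _))
    (by
      rintro j j' g t ⟨h1 : _ ≤ _, h2 : _ ≤ _⟩
      constructor
      · change _ ≤ _
        rw [map_map_app, ← R.map_type_pt s g]
        exact KOrd.monotone_map _ h1
      · change _ ≤ _
        rw [f.naturality, ← R.target.map_type_pt c g]
        exact KOrd.monotone_map _ h2)
  exact ⟨y', R.type_le_of_pt fun j => (hy' j).1.trans_eq (R.comap_app_pt y' j).symm,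
    R.target.type_le_of_pt fun j => (hy' j).2⟩

end HomPresentation

/-! ### Multiple pushouts -/

/-- The result of pushing out finitely many maps `σ t : n t ⟶ m t` along maps `a t : n t ⟶ d`. -/
structure MultiPushout {T : Type v} (F : Finset T) {n m : T → C} (σ : ∀ t, n t ⟶ m t) {d : C}
    (a : ∀ t ∈ F, n t ⟶ d) where
  pt : C
  base : d ⟶ pt
  leg : ∀ t ∈ F, m t ⟶ pt
  comm : ∀ t (h : t ∈ F), a t h ≫ base = σ t ≫ leg t h
  exists_desc : ∀ {W : C} (f : d ⟶ W) (g : ∀ t ∈ F, m t ⟶ W),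
    (∀ t (h : t ∈ F), a t h ≫ f = σ t ≫ g t h) →
      ∃ e : pt ⟶ W, base ≫ e = f ∧ ∀ t (h : t ∈ F), leg t h ≫ e = g t h
  hom_ext : ∀ {W : C} {e e' : pt ⟶ W}, base ≫ e = base ≫ e' →
    (∀ t (h : t ∈ F), leg t h ≫ e = leg t h ≫ e') → e = e'
  -- Exact restriction to the base lets this be iterated: interpolation in a pushout gives a point
  -- whose restriction lies below the given one, and boundedness raises it to an equality without
  -- losing `τ t ≤ _`.
  lift : ∀ {S : Cᵒᵖ ⥤ KOrd.{v}}, IsPolyadic S → ∀ (s : S.obj (op d)) (τ : ∀ t, S.obj (op (m t))),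
    (∀ t (h : t ∈ F), S.map (σ t).op (τ t) = S.map (a t h).op s) →
      ∃ s' : S.obj (op pt), S.map base.op s' = s ∧
        ∀ t (h : t ∈ F), τ t ≤ S.map (leg t h).op s'
  -- Here the type on the base may rise, which can break the hypothesis at a further index; hence at
  -- most one index is allowed.
  lift_le : ∀ {S : Cᵒᵖ ⥤ KOrd.{v}}, IsPolyadic S → ∀ (s : S.obj (op d)) (τ : ∀ t, S.obj (op (m t))),
    F.card ≤ 1 → (∀ t (h : t ∈ F), S.map (a t h).op s ≤ S.map (σ t).op (τ t)) →
      ∃ s' : S.obj (op pt), s ≤ S.map base.op s' ∧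
        ∀ t (h : t ∈ F), S.map (leg t h).op s' ≤ τ t

/-- Induction on `F`, with one binary pushout for each new index. -/
theorem nonempty_multiPushout [HasPushouts C] {T : Type v} (F : Finset T) {n m : T → C}
    (σ : ∀ t, n t ⟶ m t) {d : C} (a : ∀ t ∈ F, n t ⟶ d) : Nonempty (MultiPushout F σ a) := by
  classical
  induction F using Finset.induction_on with
  | empty =>
    exact ⟨{ pt := d, base := 𝟙 d, leg := fun t h => absurd h (Finset.notMem_empty t)
             comm := fun t h => absurd h (Finset.notMem_empty t)
             exists_desc := fun f g _ => ⟨f, Category.id_comp f,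
              fun t h => absurd h (Finset.notMem_empty t)⟩
             hom_ext := fun h _ => by simpa using h
             lift := fun _ s _ _ => ⟨s, KOrd.map_id_apply _ s,
              fun t h => absurd h (Finset.notMem_empty t)⟩
             lift_le := fun _ s _ _ _ => ⟨s, (KOrd.map_id_apply _ s).ge,
              fun t h => absurd h (Finset.notMem_empty t)⟩ }⟩
  | insert t₀ F ht₀ ih =>
    obtain ⟨M⟩ := ih fun t h => a t (Finset.mem_insert_of_mem h)
    have h₀ : t₀ ∈ insert t₀ F := Finset.mem_insert_self t₀ F
    let b : n t₀ ⟶ M.pt := a t₀ h₀ ≫ M.base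
    have sq : IsPushout b (σ t₀) (pushout.inl b (σ t₀)) (pushout.inr b (σ t₀)) :=
      IsPushout.of_hasPushout _ _
    have mem_of_ne : ∀ {t}, t ∈ insert t₀ F → t ≠ t₀ → t ∈ F := fun h h' =>
      (Finset.mem_insert.1 h).resolve_left h'
    let leg : ∀ t ∈ insert t₀ F, m t ⟶ pushout b (σ t₀) := fun t h =>
      if h' : t = t₀ then eqToHom (by rw [h']) ≫ pushout.inr b (σ t₀)
      else M.leg t (mem_of_ne h h') ≫ pushout.inl b (σ t₀)
    have leg_self : ∀ h, leg t₀ h = pushout.inr b (σ t₀) := fun h => by simp [leg]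
    have leg_mem : ∀ t h h', leg t h = M.leg t h' ≫ pushout.inl b (σ t₀) := fun t h h' => by
      have : t ≠ t₀ := fun e => ht₀ (e ▸ h')
      simp [leg, this]
    refine ⟨{ pt := pushout b (σ t₀), base := M.base ≫ pushout.inl b (σ t₀), leg := leg
              comm := ?_, exists_desc := ?_, hom_ext := ?_, lift := ?_, lift_le := ?_ }⟩
    · intro t h
      by_cases h' : t = t₀
      · subst h'
        rw [leg_self h, ← Category.assoc]
        exact sq.w
      · rw [leg_mem t h (mem_of_ne h h'), ← Category.assoc, ← Category.assoc]
        rw [M.comm t (mem_of_ne h h')]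
    · intro W f g hfg
      obtain ⟨e, he, he'⟩ := M.exists_desc f (fun t h => g t (Finset.mem_insert_of_mem h))
        fun t h => hfg t _
      have hb : b ≫ e = σ t₀ ≫ g t₀ h₀ := by rw [Category.assoc, he, hfg]
      refine ⟨sq.desc e (g t₀ h₀) hb, ?_, ?_⟩
      · rw [Category.assoc, sq.inl_desc, he]
      · intro t h
        by_cases h' : t = t₀
        · subst h'
          rw [leg_self h, sq.inr_desc]
        · rw [leg_mem t h (mem_of_ne h h'), Category.assoc, sq.inl_desc, he']
    · intro W e e' h1 h2
      refine sq.hom_ext (M.hom_ext ?_ ?_) ?_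
      · simpa using h1
      · intro t h
        have := h2 t (Finset.mem_insert_of_mem h)
        rw [leg_mem t (Finset.mem_insert_of_mem h) h] at this
        simpa using this
      · simpa [leg_self] using h2 t₀ h₀
    · intro S hS s τ hτ
      obtain ⟨s₁, hs₁, hs₁'⟩ := M.lift hS s τ fun t h => hτ t _
      have h1 : S.map (σ t₀).op (τ t₀) ≤ S.map b.op s₁ := by
        rw [KOrd.map_comp_apply, hs₁, hτ t₀ h₀]
      obtain ⟨s₂, hs₂, hs₂'⟩ := hS.interpolation sq.flip _ _ h1
      obtain ⟨s₃, hs₃, hs₃'⟩ := isBoundedMap_iff.1 (hS.bounded _) _ _ hs₂'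
      refine ⟨s₃, ?_, ?_⟩
      · rw [KOrd.map_comp_apply, hs₃', hs₁]
      · intro t h
        by_cases h' : t = t₀
        · subst h'
          rw [leg_self h]
          exact hs₂.trans (KOrd.monotone_map _ hs₃)
        · rw [leg_mem t h (mem_of_ne h h'), KOrd.map_comp_apply, hs₃']
          exact hs₁' t _
    · intro S hS s τ hF hτ
      have hF' : F = ∅ := by
        rw [Finset.card_insert_of_notMem ht₀] at hF
        exact Finset.card_eq_zero.1 (by omega)
      obtain ⟨s₁, hs₁, -⟩ := M.lift hS s τ fun t h => by simp [hF'] at h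
      have h1 : S.map b.op s₁ ≤ S.map (σ t₀).op (τ t₀) := by
        rw [KOrd.map_comp_apply, hs₁]
        exact hτ t₀ h₀
      obtain ⟨s₂, hs₂, hs₂'⟩ := hS.interpolation sq _ _ h1
      refine ⟨s₂, ?_, ?_⟩
      · rw [KOrd.map_comp_apply, ← hs₁]
        exact KOrd.monotone_map _ hs₂
      · intro t h
        have h' : t = t₀ := by simpa [hF'] using h
        subst h'
        rw [leg_self h]
        exact hs₂'

theorem DirectedPresentation.isIndObject {X : Cᵒᵖ ⥤ Type v} (R : DirectedPresentation X) :
    IsIndObject X :=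
  ⟨⟨{ I := R.J, F := R.D, ι := R.ι, isColimit := R.isColimit }⟩⟩

/-! ### Adjoining points to an ind-object -/

/-- For a family of points `p t : X (n t)` and maps `σ t : n t ⟶ m t` there is a universal way to
adjoin points over the `p t` along the `σ t`; types extend to it. -/
theorem exists_adjunction_of_points [HasPushouts C] {X : Cᵒᵖ ⥤ Type v} (hX : IsIndObject X)
    {T : Type v} {n m : T → C} (σ : ∀ t, n t ⟶ m t) (p : ∀ t, X.obj (op (n t))) :
    ∃ (Y : Cᵒᵖ ⥤ Type v) (h : X ⟶ Y) (c : ∀ t, Y.obj (op (m t))), IsIndObject Y ∧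
      Nonempty (HomPresentation h) ∧
      (∀ t, Y.map (σ t).op (c t) = h.app (op (n t)) (p t)) ∧
      (∀ {S : Cᵒᵖ ⥤ KOrd.{v}}, IsPolyadic S → ∀ (x : TypeOver X S) (τ : ∀ t, S.obj (op (m t))),
        (∀ t, S.map (σ t).op (τ t) = x.app (n t) (p t)) →
          ∃ y : TypeOver Y S, y.comap h = x ∧ ∀ t, τ t ≤ y.app (m t) (c t)) ∧
      (Subsingleton T → ∀ {S : Cᵒᵖ ⥤ KOrd.{v}}, IsPolyadic S → ∀ (x : TypeOver X S)
        (τ : ∀ t, S.obj (op (m t))), (∀ t, x.app (n t) (p t) ≤ S.map (σ t).op (τ t)) →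
          ∃ y : TypeOver Y S, x ≤ y.comap h ∧ ∀ t, y.app (m t) (c t) ≤ τ t) := by
  classical
  obtain ⟨R⟩ := exists_directedPresentation hX
  choose j a ha using fun t => R.exists_rep (p t)
  -- A stage consists of a stage of `X` and a finite set of indices whose points are already defined
  -- there. The ind-object `Y` is the colimit of the corresponding multiple pushouts.
  let K : Type v := {k : R.J × Finset T // ∀ t ∈ k.2, j t ≤ k.1}
  let b : ∀ (k : K), ∀ t ∈ k.1.2, n t ⟶ R.D.obj k.1.1 := fun k t h =>
    a t ≫ R.D.map (homOfLE (k.2 t h))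
  have hb : ∀ (k : K) t (h : t ∈ k.1.2), X.map (b k t h).op (R.pt k.1.1) = p t := by
    intro k t h
    rw [presheaf_map_comp_apply, R.map_pt, ha]
  let M : ∀ k : K, MultiPushout k.1.2 σ (b k) := fun k => (nonempty_multiPushout _ _ _).some
  have hexists : ∀ {k k' : K} (g : k ⟶ k'), ∃ e : (M k).pt ⟶ (M k').pt,
      (M k).base ≫ e = R.D.map (homOfLE (leOfHom g).1) ≫ (M k').base ∧
        ∀ t (h : t ∈ k.1.2), (M k).leg t h ≫ e = (M k').leg t ((leOfHom g).2 h) := by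
    intro k k' g
    refine (M k).exists_desc _ _ fun t h => ?_
    rw [← (M k').comm, Category.assoc, ← Category.assoc (R.D.map _), ← R.D.map_comp,
      ← Category.assoc]
    rfl
  choose e he he' using @hexists
  let Z : K ⥤ C :=
    { obj := fun k => (M k).pt
      map := fun g => e g
      map_id := fun k => (M k).hom_ext
        (by
          rw [he, Category.comp_id]
          exact (congrArg (· ≫ (M k).base) (R.D.map_id _)).trans (Category.id_comp _))
        (fun t h => by rw [he', Category.comp_id])
      map_comp := fun {k k' k''} g g' => (M k).hom_ext
        (by
          rw [he, ← Category.assoc, he, Category.assoc, he, ← Category.assoc, ← R.D.map_comp]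
          rfl)
        (fun t h => by rw [he', ← Category.assoc, he', he']) }
  have hdir : IsDirectedOrder K := ⟨fun k k' => by
    obtain ⟨i, hi, hi'⟩ := exists_ge_ge k.1.1 k'.1.1
    refine ⟨⟨(i, k.1.2 ∪ k'.1.2), fun t h => ?_⟩, ⟨hi, Finset.subset_union_left⟩,
      ⟨hi', Finset.subset_union_right⟩⟩
    rcases Finset.mem_union.1 h with h | h
    · exact (k.2 t h).trans hi
    · exact (k'.2 t h).trans hi'⟩
  -- The stages with nothing adjoined receive the generic points of `X` and define `h`.
  let k₀ : R.J → K := fun i => ⟨(i, ∅), fun t h => absurd h (Finset.notMem_empty t)⟩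
  have hne : Nonempty K := R.nonempty.map k₀
  let Y : Cᵒᵖ ⥤ Type v := colimit (Z ⋙ yoneda)
  let R' : DirectedPresentation Y :=
    { J := K, D := Z, ι := (colimit.cocone (Z ⋙ yoneda)).ι
      isColimit := colimit.isColimit (Z ⋙ yoneda) }
  have hbase : ∀ {k k' : K} (g : k ⟶ k'), Y.map (R.D.map (homOfLE (leOfHom g).1)).op
      (Y.map (M k').base.op (R'.pt k')) = Y.map (M k).base.op (R'.pt k) := by
    intro k k' g
    rw [← presheaf_map_comp_apply, ← he, presheaf_map_comp_apply]
    exact congrArg _ (R'.map_pt g)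
  obtain ⟨h, hh⟩ := R.exists_glue (Y := Y)
    (fun i => Y.map (M (k₀ i)).base.op (R'.pt (k₀ i)))
    (fun {i i'} g => hbase (k := k₀ i) (k' := k₀ i') (homOfLE ⟨leOfHom g, le_rfl⟩))
  have hk : ∀ k : K, h.app _ (R.pt k.1.1) = Y.map (M k).base.op (R'.pt k) := by
    intro k
    rw [hh]
    have hid : R.D.map (homOfLE (le_refl k.1.1)) = 𝟙 _ := R.D.map_id _
    have hb := hbase (k := k₀ k.1.1) (k' := k) (homOfLE ⟨le_rfl, Finset.empty_subset _⟩)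
    refine hb.symm.trans (Eq.trans ?_ (presheaf_map_id_apply Y _))
    exact congrArg (fun f : R.D.obj k.1.1 ⟶ R.D.obj k.1.1 =>
      Y.map f.op (Y.map (M k).base.op (R'.pt k))) hid
  let H : HomPresentation h :=
    { target := R'
      E :=
        { obj := fun k => R.D.obj k.1.1
          map := fun g => R.D.map (homOfLE (leOfHom g).1)
          map_id := fun k => R.D.map_id _
          map_comp := fun g g' => by rw [← R.D.map_comp]; rfl }
      α := { app := fun k => (M k).base, naturality := fun k k' g => (he g).symm }
      pt := fun k => R.pt k.1.1
      map_pt := fun g => R.map_pt _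
      hom_pt := hk
      exists_rep := fun q => by
        obtain ⟨i, d, hd⟩ := R.exists_rep q
        exact ⟨k₀ i, d, hd⟩ }
  -- The earliest chosen stage at which the new point over `p t` is available.
  let kT : T → K := fun t => ⟨(j t, {t}), fun t' h => by rw [Finset.mem_singleton.1 h]⟩
  let c : ∀ t, Y.obj (op (m t)) := fun t =>
    Y.map ((M (kT t)).leg t (Finset.mem_singleton_self t)).op (R'.pt (kT t))
  have rep_c : ∀ {S : Cᵒᵖ ⥤ KOrd.{v}} (y : TypeOver Y S) t, y.app (m t) (c t) =
      S.map ((M (kT t)).leg t (Finset.mem_singleton_self t)).op (y.app _ (R'.pt (kT t))) :=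
    fun y t => y.naturality _ _
  refine ⟨Y, h, c, R'.isIndObject, ⟨H⟩, ?_, ?_, ?_⟩
  · intro t
    rw [← presheaf_map_comp_apply, ← (M (kT t)).comm, presheaf_map_comp_apply, ← hk,
      ← presheaf_hom_naturality, hb (kT t) t (Finset.mem_singleton_self t)]
  · intro S hS x τ hτ
    obtain ⟨y, hy⟩ := R'.exists_type (S := S)
      (fun k => {s | S.map (M k).base.op s = x.app _ (R.pt k.1.1)} ∩
        ⋂ t, ⋂ h : t ∈ k.1.2, {s | τ t ≤ S.map ((M k).leg t h).op s})
      (fun k => (isClosed_eq (KOrd.continuous_map _) continuous_const).inter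
        (isClosed_iInter fun t => isClosed_iInter fun h =>
          isClosed_le continuous_const (KOrd.continuous_map _)))
      (by
        intro k
        obtain ⟨s, hs, hs'⟩ := (M k).lift hS (x.app _ (R.pt k.1.1)) τ (fun t h => by
          rw [hτ, ← x.naturality, hb k t h])
        exact ⟨s, hs, Set.mem_iInter.2 fun t => Set.mem_iInter.2 fun h => hs' t h⟩)
      (by
        rintro k k' g s ⟨hs : _ = _, hs'⟩
        constructor
        · change S.map _ (S.map (e g).op s) = _
          rw [← KOrd.map_comp_apply, he, KOrd.map_comp_apply, hs, ← x.naturality, R.map_pt]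
        · refine Set.mem_iInter.2 fun t => Set.mem_iInter.2 fun h => ?_
          change _ ≤ S.map _ (S.map (e g).op s)
          rw [← KOrd.map_comp_apply, he']
          exact Set.mem_iInter.1 (Set.mem_iInter.1 hs' t) _)
    refine ⟨y, le_antisymm (H.type_le_of_pt fun k => ?_) (H.type_le_of_pt fun k => ?_), ?_⟩
    · rw [H.comap_app_pt]
      exact (hy k).1.le
    · rw [H.comap_app_pt]
      exact (hy k).1.ge
    · intro t
      rw [rep_c]
      exact Set.mem_iInter.1 (Set.mem_iInter.1 (hy (kT t)).2 t) (Finset.mem_singleton_self t)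
  · intro hT S hS x τ hτ
    obtain ⟨y, hy⟩ := R'.exists_type (S := S)
      (fun k => {s | x.app _ (R.pt k.1.1) ≤ S.map (M k).base.op s} ∩
        ⋂ t, ⋂ h : t ∈ k.1.2, {s | S.map ((M k).leg t h).op s ≤ τ t})
      (fun k => (isClosed_le continuous_const (KOrd.continuous_map _)).inter
        (isClosed_iInter fun t => isClosed_iInter fun h =>
          isClosed_le (KOrd.continuous_map _) continuous_const))
      (by
        intro k
        obtain ⟨s, hs, hs'⟩ := (M k).lift_le hS (x.app _ (R.pt k.1.1)) τ
          (Finset.card_le_one_of_subsingleton _) (fun t h => by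
            rw [← x.naturality, hb k t h]
            exact hτ t)
        exact ⟨s, hs, Set.mem_iInter.2 fun t => Set.mem_iInter.2 fun h => hs' t h⟩)
      (by
        rintro k k' g s ⟨hs : _ ≤ _, hs'⟩
        constructor
        · change _ ≤ S.map _ (S.map (e g).op s)
          rw [← KOrd.map_comp_apply, he, KOrd.map_comp_apply,
            ← R.map_type_pt x (homOfLE (leOfHom g).1)]
          exact KOrd.monotone_map _ hs
        · refine Set.mem_iInter.2 fun t => Set.mem_iInter.2 fun h => ?_
          change S.map _ (S.map (e g).op s) ≤ _
          rw [← KOrd.map_comp_apply, he']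
          exact Set.mem_iInter.1 (Set.mem_iInter.1 hs' t) _)
    refine ⟨y, H.type_le_of_pt fun k => ?_, fun t => ?_⟩
    · rw [H.comap_app_pt]
      exact (hy k).1
    · rw [rep_c]
      exact Set.mem_iInter.1 (Set.mem_iInter.1 (hy (kT t)).2 t) (Finset.mem_singleton_self t)

/-! ### The Henkin construction -/

/-- Every element of `S` above the type of a point of `X` is dominated by the type of a witness
in `Y`. -/
def Solves {X Y : Cᵒᵖ ⥤ Type v} {S : Cᵒᵖ ⥤ KOrd.{v}} (h : X ⟶ Y) (x : TypeOver X S)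
    (y : TypeOver Y S) : Prop :=
  ∀ {n m : C} (σ : n ⟶ m) (p : X.obj (op n)) (t : S.obj (op m)), S.map σ.op t = x.app n p →
    ∃ p' : Y.obj (op m), Y.map σ.op p' = h.app (op n) p ∧ t ≤ y.app m p'

theorem Solves.mono {X Y : Cᵒᵖ ⥤ Type v} {S : Cᵒᵖ ⥤ KOrd.{v}} {h : X ⟶ Y} {x : TypeOver X S}
    {y y' : TypeOver Y S} (hs : Solves h x y) (hy : y ≤ y') : Solves h x y' := by
  intro n m σ p t ht
  obtain ⟨p', hp', htp'⟩ := hs σ p t ht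
  exact ⟨p', hp', htp'.trans (hy _ _)⟩

/-- A witness is adjoined for every triple of an arrow, a point and an element over its type.
Essential smallness makes the triples between chosen representatives a set, and isomorphisms
transport the other problems to these. -/
theorem exists_solves [EssentiallySmall.{v} C] [HasPushouts C] {X : Cᵒᵖ ⥤ Type v}
    (hX : IsIndObject X) {S : Cᵒᵖ ⥤ KOrd.{v}} (hS : IsPolyadic S) (x : TypeOver X S) :
    ∃ (Y : Cᵒᵖ ⥤ Type v) (h : X ⟶ Y) (y : TypeOver Y S), IsIndObject Y ∧
      Nonempty (HomPresentation h) ∧ y.comap h = x ∧ Solves h x y := by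
  let E : SmallModel.{v} C → C := (equivSmallModel C).inverse.obj
  let T : Type v := Σ (n m : SmallModel.{v} C),
    {t : (E n ⟶ E m) × X.obj (op (E n)) × S.obj (op (E m)) // S.map t.1.op t.2.2 = x.app _ t.2.1}
  obtain ⟨Y, h, c, hY, hh, hc, hlift, -⟩ := exists_adjunction_of_points hX
    (T := T) (n := fun t => E t.1) (m := fun t => E t.2.1) (fun t => t.2.2.1.1)
    (fun t => t.2.2.1.2.1)
  obtain ⟨y, hyx, hy⟩ := hlift hS x (fun t => t.2.2.1.2.2) (fun t => t.2.2.2)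
  refine ⟨Y, h, y, hY, hh, hyx, ?_⟩
  intro n m σ p t ht
  let i : ∀ n : C, n ≅ E ((equivSmallModel C).functor.obj n) := (equivSmallModel C).unitIso.app
  -- The given problem is conjugated into the small model; the witness is carried back along `(i
  -- m).hom`.
  have hi : S.map ((i n).inv ≫ σ ≫ (i m).hom).op (S.map (i m).inv.op t) =
      x.app _ (X.map (i n).inv.op p) := by
    rw [← KOrd.map_comp_apply, Category.assoc, Category.assoc, Iso.hom_inv_id, Category.comp_id,
      KOrd.map_comp_apply, ht, x.naturality]
  let τ : T := ⟨(equivSmallModel C).functor.obj n, (equivSmallModel C).functor.obj m,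
    ((i n).inv ≫ σ ≫ (i m).hom, X.map (i n).inv.op p, S.map (i m).inv.op t), hi⟩
  refine ⟨Y.map (i m).hom.op (c τ), ?_, ?_⟩
  · have h1 : Y.map ((i n).inv ≫ σ ≫ (i m).hom).op (c τ) =
        h.app _ (X.map (i n).inv.op p) := hc τ
    rw [← presheaf_map_comp_apply]
    have h2 : σ ≫ (i m).hom = (i n).hom ≫ (i n).inv ≫ σ ≫ (i m).hom := by simp
    rw [h2, presheaf_map_comp_apply, h1, ← presheaf_hom_naturality, ← presheaf_map_comp_apply,
      Iso.hom_inv_id, presheaf_map_id_apply]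
  · rw [y.naturality]
    have h1 := KOrd.monotone_map (S.map (i m).hom.op) (hy τ)
    change S.map _ (S.map (i m).inv.op t) ≤ _ at h1
    rwa [← KOrd.map_comp_apply, Iso.hom_inv_id, KOrd.map_id_apply] at h1

variable {S P Q : Cᵒᵖ ⥤ KOrd.{v}}

/-- A pair of agreeing types on an ind-object such that the second is maximal over `P`. -/
structure MaximalPair (f : KOrdTrans S P) (g : KOrdTrans Q P) where
  X : Cᵒᵖ ⥤ Type v
  isInd : IsIndObject X
  left : TypeOver X S
  right : TypeOver X Q
  agree : left.map f = right.map g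
  maximal : right.IsMaximalOver g

/-- Maps of ind-objects along which both types restrict exactly. -/
structure MaximalPair.Hom {f : KOrdTrans S P} {g : KOrdTrans Q P} (A B : MaximalPair f g) where
  hom : A.X ⟶ B.X
  left : B.left.comap hom = A.left
  right : B.right.comap hom = A.right

namespace MaximalPair

variable {f : KOrdTrans S P} {g : KOrdTrans Q P}

/-- Composition of maps of maximal pairs. -/
def Hom.comp {A B D : MaximalPair f g} (a : Hom A B) (b : Hom B D) : Hom A D where
  hom := a.hom ≫ b.hom
  left := by rw [TypeOver.comap_comp, b.left, a.left]
  right := by rw [TypeOver.comap_comp, b.right, a.right]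

/-- A type below the second type of an extension can be raised to a maximal one that agrees with the
first type and restricts to the given one. -/
theorem exists_right (hg : ∀ n, IsBoundedMap (g.app n)) (A : MaximalPair f g)
    {Y : Cᵒᵖ ⥤ Type v} (hY : IsIndObject Y) {h : A.X ⟶ Y} {x : TypeOver Y S} {q : TypeOver Y Q}
    (hx : x.comap h = A.left) (hq : A.right ≤ q.comap h) (hqx : q.map g ≤ x.map f) :
    ∃ q' : TypeOver Y Q, q ≤ q' ∧ x.map f = q'.map g ∧ q'.comap h = A.right ∧
      q'.IsMaximalOver g := by
  obtain ⟨q₁, hq₁, hq₁'⟩ := TypeOver.exists_map_eq hY hg hqx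
  obtain ⟨q₂, hq₂, hq₂', hmax⟩ := TypeOver.exists_isMaximalOver hY g q₁
  refine ⟨q₂, hq₁.trans hq₂, by rw [hq₂', hq₁'], ?_, hmax⟩
  -- The restriction of `q₂` lies above `A.right` and has the same image in `P`, namely that of
  -- `A.left`. Maximality forces equality, so nothing old is changed.
  refine A.maximal _ (hq.trans (TypeOver.comap_mono h (hq₁.trans hq₂))) ?_
  rw [← TypeOver.comap_map, hq₂', hq₁', TypeOver.comap_map, hx, A.agree]

/-- The union of a chain of maximal pairs. -/
theorem exists_union (A : ℕ → MaximalPair f g) (a : ∀ n, Hom (A n) (A (n + 1))) :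
    ∃ (Y : Cᵒᵖ ⥤ Type v) (h : ∀ n, (A n).X ⟶ Y) (x : TypeOver Y S) (y : TypeOver Y Q),
      IsIndObject Y ∧ (∀ n, (a n).hom ≫ h (n + 1) = h n) ∧
      (∀ {k : C} (p : Y.obj (op k)), ∃ n q, (h n).app (op k) q = p) ∧
      (∀ n, x.comap (h n) = (A n).left) ∧ ∀ n, y.comap (h n) = (A n).right := by
  let F : ℕ ⥤ Cᵒᵖ ⥤ Type v := Functor.ofSequence fun n => (a n).hom
  -- The chain is reindexed by a copy of the naturals in the universe of the presheaves.
  let D : ULift.{v} ℕ ⥤ ℕ := (show Monotone (ULift.down : ULift.{v} ℕ → ℕ) from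
    fun _ _ h => h).functor
  let αl : F ⟶ (Functor.const ℕ).obj (KOrd.points S) := NatTrans.ofSequence
    (fun n => (A n).left.toHom) (fun n => by
      rw [Functor.ofSequence_map_homOfLE_succ, ← (a n).left]
      rfl)
  let αr : F ⟶ (Functor.const ℕ).obj (KOrd.points Q) := NatTrans.ofSequence
    (fun n => (A n).right.toHom) (fun n => by
      rw [Functor.ofSequence_map_homOfLE_succ, ← (a n).right]
      rfl)
  let cl : Cocone (D ⋙ F) := ⟨_, Functor.whiskerLeft D αl⟩
  let cr : Cocone (D ⋙ F) := ⟨_, Functor.whiskerLeft D αr⟩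
  refine ⟨colimit (D ⋙ F), fun n => colimit.ι (D ⋙ F) ⟨n⟩,
    TypeOver.ofHom (colimit.desc (D ⋙ F) cl), TypeOver.ofHom (colimit.desc (D ⋙ F) cr),
    isIndObject_colimit _ _ fun n => (A n.down).isInd, ?_, ?_, ?_, ?_⟩
  · intro n
    have h := colimit.w (D ⋙ F) (homOfLE (show (⟨n⟩ : ULift.{v} ℕ) ≤ ⟨n + 1⟩ from Nat.le_succ n))
    have h' : F.map (homOfLE (Nat.le_add_right n 1)) = (a n).hom :=
      Functor.ofSequence_map_homOfLE_succ (fun n => (a n).hom) n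
    exact (congrArg (· ≫ colimit.ι (D ⋙ F) ⟨n + 1⟩) h'.symm).trans h
  · intro k p
    obtain ⟨n, q, hq⟩ := Types.jointly_surjective _
      (isColimitOfPreserves ((evaluation _ _).obj (op k)) (colimit.isColimit (D ⋙ F))) p
    exact ⟨n.down, q, hq⟩
  · intro n
    refine TypeOver.app_injective (funext fun k => funext fun p => ?_)
    exact congrArg (fun e => e.app (op k) p) (colimit.ι_desc cl ⟨n⟩)
  · intro n
    refine TypeOver.app_injective (funext fun k => funext fun p => ?_)
    exact congrArg (fun e => e.app (op k) p) (colimit.ι_desc cr ⟨n⟩)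

variable [EssentiallySmall.{v} C] [HasPushouts C]

/-- The left type is extended exactly to one with witnesses. Backward interpolation for `g` then
gives a right type above the old one with image below that of the left type, which is what
`exists_right` needs. -/
theorem exists_solves_left (hS : IsPolyadic S) (hg : g.IsIntuitionistic) (A : MaximalPair f g) :
    ∃ (B : MaximalPair f g) (a : Hom A B), Solves a.hom A.left B.left := by
  obtain ⟨Y, h, x, hY, ⟨R⟩, hx, hsol⟩ := Polyadic.exists_solves A.isInd hS A.left
  obtain ⟨q, hq, hqx⟩ := R.exists_back hg (s := A.right) (c := x.map f) (by
    rw [TypeOver.comap_map, hx, A.agree])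
  obtain ⟨q', -, hagree, hr, hmax⟩ := A.exists_right hg.bounded hY hx hq hqx
  exact ⟨⟨Y, hY, x, q', hagree, hmax⟩, ⟨h, hx, hr⟩, hsol⟩

/-- Two corrections are needed. Forward interpolation for `f` gives a left type whose restriction is
only below the old one, so it is raised to restrict exactly. The right type is then raised to agree
with it; raising preserves the witnesses. -/
theorem exists_solves_right (hS : IsPolyadic S) (hQ : IsPolyadic Q) (hf : f.IsMorphism)
    (hg : ∀ n, IsBoundedMap (g.app n)) (A : MaximalPair f g) :
    ∃ (B : MaximalPair f g) (a : Hom A B), Solves a.hom A.right B.right := by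
  obtain ⟨Y, h, y, hY, ⟨R⟩, hy, hsol⟩ := Polyadic.exists_solves A.isInd hQ A.right
  obtain ⟨s, hs, hsx⟩ := R.exists_forth hf (s := A.left) (c := y.map g) (by
    rw [TypeOver.comap_map, hy, A.agree])
  obtain ⟨x, hsx', hx⟩ := R.exists_comap_eq hS hsx
  obtain ⟨q', hyq, hagree, hr, hmax⟩ := A.exists_right hg hY hx hy.ge
    (hs.trans (TypeOver.map_mono f hsx'))
  exact ⟨⟨Y, hY, x, q', hagree, hmax⟩, ⟨h, hx, hr⟩, hsol.mono hyq⟩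

theorem exists_solves (hS : IsPolyadic S) (hQ : IsPolyadic Q) (hf : f.IsIntuitionistic)
    (hg : g.IsIntuitionistic) (A : MaximalPair f g) :
    ∃ (B : MaximalPair f g) (a : Hom A B), Solves a.hom A.left B.left ∧
      Solves a.hom A.right B.right := by
  obtain ⟨B, a, ha⟩ := A.exists_solves_left hS hg
  obtain ⟨D, b, hb⟩ := B.exists_solves_right hS hQ hf.isMorphism hg.bounded
  refine ⟨D, a.comp b, ?_, ?_⟩
  -- The second extension does not change the left type on `B`, so the witness found there keeps its
  -- type.
  · intro n m σ p t ht
    obtain ⟨p', hp', htp'⟩ := ha σ p t ht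
    refine ⟨b.hom.app _ p', ?_, ?_⟩
    · rw [← presheaf_hom_naturality, hp']
      rfl
    · rw [← b.left] at htp'
      exact htp'
  · intro n m σ p t ht
    rw [← a.right] at ht
    exact hb σ _ t ht

/-- Every maximal pair extends, without changing the types, to a pair of models. -/
theorem exists_agreeingPair (hS : IsPolyadic S) (hQ : IsPolyadic Q) (hSo : IsOpenPolyadic S)
    (hQo : IsOpenPolyadic Q) (hf : f.IsIntuitionistic) (hg : g.IsIntuitionistic)
    (A : MaximalPair f g) :
    ∃ (B : AgreeingPair f g) (h : A.X ⟶ B.X), B.left.comap h = A.left ∧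
      B.right.comap h = A.right := by
  choose next a ha ha' using MaximalPair.exists_solves hS hQ hf hg
  -- Each point of the union comes from some stage `i`, and its problems are solved at stage `i +
  -- 1`.
  let seq : ℕ → MaximalPair f g := fun n => Nat.rec A (fun _ => next) n
  obtain ⟨Y, h, x, y, hY, hh, hsurj, hx, hy⟩ := exists_union seq fun n => a (seq n)
  have hh' : ∀ n {k : C} (p : (seq n).X.obj (op k)),
      (h (n + 1)).app (op k) ((a (seq n)).hom.app (op k) p) = (h n).app (op k) p := by
    intro n k p
    rw [← hh n]
    rfl
  refine ⟨⟨Y, hY, x, TypeOver.isStructure_of_witnesses hSo ?_, y,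
    TypeOver.isStructure_of_witnesses hQo ?_, ?_⟩, h 0, hx 0, hy 0⟩
  · intro n m σ p t ht
    obtain ⟨i, q, rfl⟩ := hsurj p
    obtain ⟨p', hp', htp'⟩ := ha (seq i) σ q t (by rw [ht, ← hx i]; rfl)
    refine ⟨(h (i + 1)).app _ p', ?_, ?_⟩
    · rw [← presheaf_hom_naturality, hp', hh']
    · have h1 := hx (i + 1)
      change x.comap (h (i + 1)) = (next (seq i)).left at h1
      rw [← h1] at htp'
      exact htp'
  · intro n m σ p t ht
    obtain ⟨i, q, rfl⟩ := hsurj p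
    obtain ⟨p', hp', htp'⟩ := ha' (seq i) σ q t (by rw [ht, ← hy i]; rfl)
    refine ⟨(h (i + 1)).app _ p', ?_, ?_⟩
    · rw [← presheaf_hom_naturality, hp', hh']
    · have h1 := hy (i + 1)
      change y.comap (h (i + 1)) = (next (seq i)).right at h1
      rw [← h1] at htp'
      exact htp'
  · intro n p
    obtain ⟨i, q, rfl⟩ := hsurj p
    have h1 : (x.comap (h i)).map f = (y.comap (h i)).map g := by
      rw [hx, hy, (seq i).agree]
    exact congrArg (fun z : TypeOver _ P => z.app n q) h1

end MaximalPair

/-! ### Extensions of agreeing pairs of models -/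

/-- The type on a representable presheaf determined by an element. -/
def TypeOver.ofElement {S : Cᵒᵖ ⥤ KOrd.{w}} {n : C} (s : S.obj (op n)) :
    TypeOver (yoneda.obj n) S where
  app k a := S.map (show k ⟶ n from a).op s
  naturality σ a := KOrd.map_comp_apply S σ (show _ ⟶ n from a) s

namespace AgreeingPair

variable {S P Q : Cᵒᵖ ⥤ KOrd.{v}} {f : KOrdTrans S P} {g : KOrdTrans Q P}

theorem map_left_eq (A : AgreeingPair f g) : A.left.map f = A.right.map g :=
  TypeOver.app_injective (funext fun n => funext fun p => A.agree n p)

/-- The pair of models with the roles of `S` and `Q` exchanged. -/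
def swap (A : AgreeingPair f g) : AgreeingPair g f :=
  ⟨A.X, A.isInd, A.right, A.right_isStructure, A.left, A.left_isStructure,
    fun n p => (A.agree n p).symm⟩

variable [EssentiallySmall.{v} C] [HasPushouts C]

/-- A point of an agreeing pair together with an element of `S` above its type is realized in an
extension. -/
theorem exists_extension_left (hS : IsPolyadic S) (hQ : IsPolyadic Q) (hSo : IsOpenPolyadic S)
    (hQo : IsOpenPolyadic Q) (hf : f.IsIntuitionistic) (hg : g.IsIntuitionistic)
    (A : AgreeingPair f g) {n m : C} (σ : n ⟶ m) (p : A.X.obj (op n)) {t : S.obj (op m)}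
    (h : A.left.app n p ≤ S.map σ.op t) :
    ∃ (B : AgreeingPair f g) (a : Hom A B) (p' : B.X.obj (op m)),
      B.X.map σ.op p' = a.hom.app (op n) p ∧ B.left.app m p' = t := by
  -- A single point is adjoined, so the lax form of the extension property applies; it gives the new
  -- point a type below `t`, which is then raised to exactly `t`.
  obtain ⟨Y, e, c, hY, ⟨R⟩, hc, -, hlift⟩ := exists_adjunction_of_points A.isInd
    (T := PUnit.{v + 1}) (fun _ => σ) (fun _ => p)
  obtain ⟨x, hx, hxt⟩ := hlift inferInstance hS A.left (fun _ => t) (fun _ => h)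
  obtain ⟨x', hxx', hx't⟩ := TypeOver.exists_app_eq hY hS x (c ⟨⟩) (hxt ⟨⟩)
  have hAx : A.left ≤ x'.comap e := hx.trans (TypeOver.comap_mono e hxx')
  obtain ⟨q, hq, hqx⟩ := R.exists_back hg (s := A.right) (c := x'.map f) (by
    rw [TypeOver.comap_map, ← A.map_left_eq]
    exact TypeOver.map_mono f hAx)
  obtain ⟨q₁, hqq₁, hq₁⟩ := TypeOver.exists_map_eq hY hg.bounded hqx
  -- The right type of `A` need not be maximal, so both types may grow along `e`. Morphisms of pairs
  -- are lax, and this is harmless.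
  obtain ⟨q₂, hqq₂, hq₂, hmax⟩ := TypeOver.exists_isMaximalOver hY g q₁
  obtain ⟨B, b, hbl, hbr⟩ := MaximalPair.exists_agreeingPair hS hQ hSo hQo hf hg
    ⟨Y, hY, x', q₂, by rw [hq₂, hq₁], hmax⟩
  refine ⟨B, ⟨e ≫ b, fun k r => ?_, fun k r => ?_⟩, b.app _ (c ⟨⟩), ?_, ?_⟩
  · have h1 : A.left ≤ B.left.comap (e ≫ b) := by
      rw [TypeOver.comap_comp, hbl]
      exact hAx
    exact h1 k r
  · have h1 : A.right ≤ B.right.comap (e ≫ b) := by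
      rw [TypeOver.comap_comp, hbr]
      exact hq.trans (TypeOver.comap_mono e (hqq₁.trans hqq₂))
    exact h1 k r
  · rw [← presheaf_hom_naturality, hc]
    rfl
  · rw [← hx't]
    exact congrArg (fun z : TypeOver Y S => z.app m (c ⟨⟩)) hbl

/-- Maximality on one side is a device of the construction and is not part of an agreeing pair, so
the two sides may be exchanged. -/
theorem exists_extension_right (hS : IsPolyadic S) (hQ : IsPolyadic Q) (hSo : IsOpenPolyadic S)
    (hQo : IsOpenPolyadic Q) (hf : f.IsIntuitionistic) (hg : g.IsIntuitionistic)
    (A : AgreeingPair f g) {n m : C} (σ : n ⟶ m) (p : A.X.obj (op n)) {t : Q.obj (op m)}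
    (h : A.right.app n p ≤ Q.map σ.op t) :
    ∃ (B : AgreeingPair f g) (a : Hom A B) (p' : B.X.obj (op m)),
      B.X.map σ.op p' = a.hom.app (op n) p ∧ B.right.app m p' = t := by
  obtain ⟨B, a, p', hp', ht⟩ := exists_extension_left hQ hS hQo hSo hg hf A.swap σ p h
  exact ⟨B.swap, ⟨a.hom, a.right_le, a.left_le⟩, p', hp', ht⟩

/-- Elements with `g q ≤ f s` are realized by a point of an agreeing pair. -/
theorem exists_point_left (hS : IsPolyadic S) (hQ : IsPolyadic Q) (hSo : IsOpenPolyadic S)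
    (hQo : IsOpenPolyadic Q) (hf : f.IsIntuitionistic) (hg : g.IsIntuitionistic) {n : C}
    {s : S.obj (op n)} {q : Q.obj (op n)} (h : g.app n q ≤ f.app n s) :
    ∃ (A : AgreeingPair f g) (p : A.X.obj (op n)), q ≤ A.right.app n p ∧ A.left.app n p = s := by
  have hY : IsIndObject (yoneda.obj n) := isIndObject_yoneda n
  -- The construction starts from the representable of `n`, on which the two elements generate
  -- types.
  have hle : (TypeOver.ofElement q).map g ≤ (TypeOver.ofElement s).map f := by
    intro k a
    change g.app k (Q.map (show k ⟶ n from a).op q) ≤ f.app k (S.map (show k ⟶ n from a).op s)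
    rw [g.naturality, f.naturality]
    exact KOrd.monotone_map _ h
  obtain ⟨q₁, hqq₁, hq₁⟩ := TypeOver.exists_map_eq hY hg.bounded hle
  obtain ⟨q₂, hqq₂, hq₂, hmax⟩ := TypeOver.exists_isMaximalOver hY g q₁
  obtain ⟨B, b, hbl, hbr⟩ := MaximalPair.exists_agreeingPair hS hQ hSo hQo hf hg
    ⟨_, hY, TypeOver.ofElement s, q₂, by rw [hq₂, hq₁], hmax⟩
  refine ⟨B, b.app (op n) (𝟙 n), ?_, ?_⟩
  · have h1 : TypeOver.ofElement q ≤ B.right.comap b := by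
      rw [hbr]
      exact hqq₁.trans hqq₂
    have h2 := h1 n (𝟙 n)
    change Q.map (𝟙 n).op q ≤ _ at h2
    rwa [KOrd.map_id_apply] at h2
  · have h2 := congrArg (fun z : TypeOver (yoneda.obj n) S => z.app n (𝟙 n)) hbl
    change _ = S.map (𝟙 n).op s at h2
    rwa [KOrd.map_id_apply] at h2

theorem exists_point_right (hS : IsPolyadic S) (hQ : IsPolyadic Q) (hSo : IsOpenPolyadic S)
    (hQo : IsOpenPolyadic Q) (hf : f.IsIntuitionistic) (hg : g.IsIntuitionistic) {n : C}
    {s : S.obj (op n)} {q : Q.obj (op n)} (h : f.app n s ≤ g.app n q) :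
    ∃ (A : AgreeingPair f g) (p : A.X.obj (op n)), s ≤ A.left.app n p ∧ A.right.app n p = q := by
  obtain ⟨A, p, hp, hp'⟩ := exists_point_left hQ hS hQo hSo hg hf h
  exact ⟨A.swap, p, hp, hp'⟩

end AgreeingPair

/-! ### Kripke models from the Kripke conditions -/

section Kripke

variable {I : Type u₁} [Category.{v₁} I] {S : Cᵒᵖ ⥤ KOrd.{w}}

/-- A sufficient condition for the Kripke conditions: every element above the type of a point is
realized over an extension of the point. -/
theorem kripkeConditions_of_exists {G : I ⥤ Model S}
    (h : ∀ (i : I) {n m : C} (σ : n ⟶ m) (p : (G.obj i).X.obj (op n)) (t : S.obj (op m)),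
      (G.obj i).type.app n p ≤ S.map σ.op t → ∃ (j : I) (a : i ⟶ j) (p' : (G.obj j).X.obj (op m)),
        (G.obj j).X.map σ.op p' = (Model.Hom.hom (G.map a)).app (op n) p ∧
          (G.obj j).type.app m p' = t) :
    KripkeConditions G where
  implication n := by
    refine isBoundedMap_iff.2 ?_
    rintro ⟨i, p⟩ t hpt
    change (G.obj i).type.app n p ≤ t at hpt
    -- Boundedness is the case of the identity arrow.
    obtain ⟨j, a, p', hp', ht⟩ := h i (𝟙 n) p t (by rwa [KOrd.map_id_apply])
    rw [presheaf_map_id_apply] at hp'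
    exact ⟨⟨j, p'⟩, ⟨a, hp'.symm⟩, ht⟩
  universal := by
    rintro n m σ ⟨i, p⟩ t hpt
    obtain ⟨j, a, p', hp', ht⟩ := h i σ p t hpt
    exact ⟨⟨j, p'⟩, ⟨a, hp'.symm⟩, ht.le⟩

/-- Existential witnesses are found in the same model; no arrow of the diagram is used. -/
theorem diagramTrans_witnessing (G : I ⥤ Model S) : (diagramTrans G).Witnessing := by
  rintro n m σ U hU hUu ⟨i, p⟩ t htU htp
  obtain ⟨p', hp', hp'U⟩ := (G.obj i).isStructure.exists_witness σ hU hUu p htU htp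
  exact ⟨⟨i, p'⟩, hp'U, le_of_eq (Sigma.ext rfl (heq_of_eq hp'))⟩

theorem KripkeConditions.isKripkeModel {G : I ⥤ Model S} (hG : KripkeConditions G)
    (hS : IsIntuitionisticPolyadic S) (hSo : IsOpenPolyadic S) : IsKripkeModel G :=
  ⟨(diagramTrans G).extend, (diagramTrans G).extend_extends,
    OrdTrans.Witnessing.isMorphism (diagramTrans_witnessing G) hSo,
    fun n => OrdTrans.bounded_extend (hG.implication n) (hS.isOpen_imp n),
    fun σ => OrdTrans.back_extend (hG.universal σ) (hS.isOpen_forall σ)⟩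

end Kripke

/-- Craig interpolation for models of open polyadic spaces. -/
theorem AgreeingPair.craig_interpolation [EssentiallySmall.{v} C] [HasPushouts C]
    {S P Q : Cᵒᵖ ⥤ KOrd.{v}} (hS : IsPolyadic S) (hQ : IsPolyadic Q) (hSo : IsOpenPolyadic S)
    (hQo : IsOpenPolyadic Q) {f : KOrdTrans S P} {g : KOrdTrans Q P} (hf : f.IsIntuitionistic)
    (hg : g.IsIntuitionistic) :
    KripkeConditions (projLeft f g) ∧ KripkeConditions (projRight f g) ∧
      (IsIntuitionisticPolyadic S → IsKripkeModel (projLeft f g)) ∧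
      (IsIntuitionisticPolyadic Q → IsKripkeModel (projRight f g)) ∧
      (∀ n : C, Interpolation (fun z : Point f g n => z.left) (fun z => z.right)
        (f.app n) (g.app n)) ∧
      (∀ n : C, Interpolation (fun z : Point f g n => z.right) (fun z => z.left)
        (g.app n) (f.app n)) := by
  have hl : KripkeConditions (projLeft f g) := kripkeConditions_of_exists
    fun A _ _ σ p t h => exists_extension_left hS hQ hSo hQo hf hg A σ p h
  have hr : KripkeConditions (projRight f g) := kripkeConditions_of_exists
    fun A _ _ σ p t h => exists_extension_right hS hQ hSo hQo hf hg A σ p h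
  refine ⟨hl, hr, fun h => hl.isKripkeModel h hSo, fun h => hr.isKripkeModel h hQo, ?_, ?_⟩
  · intro n s q h
    obtain ⟨A, p, hp, hp'⟩ := exists_point_right hS hQ hSo hQo hf hg h
    exact ⟨⟨A, p⟩, hp, hp'.le⟩
  · intro n q s h
    obtain ⟨A, p, hp, hp'⟩ := exists_point_left hS hQ hSo hQo hf hg h
    exact ⟨⟨A, p⟩, hp, hp'.le⟩

/-! ### Duality between lattices and their spectra -/

namespace Spec

section Lattice

variable {A B L M : Type*} [DistribLattice A] [BoundedOrder A] [DistribLattice B] [BoundedOrder B]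
  [DistribLattice L] [BoundedOrder L] [DistribLattice M] [BoundedOrder M]

/-- The map of spectra that is dual to a homomorphism of bounded lattices. -/
def comap (φ : BoundedLatticeHom L M) : Spec M →Co Spec L where
  toFun x :=
    { val := fun a => x.val (φ a)
      map_top := by rw [TopHomClass.map_top, x.map_top]
      map_bot := by rw [BotHomClass.map_bot, x.map_bot]
      map_sup := fun a b => by rw [SupHomClass.map_sup, x.map_sup]
      map_inf := fun a b => by rw [InfHomClass.map_inf, x.map_inf] }
  monotone' _ _ h a := h (φ a)
  continuous_toFun := continuous_induced_rng.2 (continuous_pi fun a => continuous_val (φ a))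

/-- The dual of a square with the interpolation property has the interpolation property. -/
theorem interpolation_comap {f : BoundedLatticeHom A B} {g : BoundedLatticeHom A L}
    {i : BoundedLatticeHom B M} {j : BoundedLatticeHom L M} (h : Interpolation f g i j) :
    Interpolation (comap i) (comap j) (comap f) (comap g) := by
  intro b c hbc
  obtain ⟨s, hs, hs'⟩ := exists_separating (L := M) (G := i '' {x | b.val x = true})
    (J := j '' {x | ¬ c.val x = true}) ⟨_, ⊤, b.map_top, rfl⟩ ⟨_, ⊥, by simp [c.map_bot], rfl⟩
    (by
      rintro _ ⟨x, hx, rfl⟩ _ ⟨y, hy, rfl⟩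
      exact ⟨x ⊓ y, b.val_inf_eq_true.2 ⟨hx, hy⟩, InfHomClass.map_inf i x y⟩)
    (by
      rintro _ ⟨x, hx, rfl⟩ _ ⟨y, hy, rfl⟩
      exact ⟨x ⊔ y, fun h => (c.val_sup_eq_true.1 h).elim hx hy, SupHomClass.map_sup j x y⟩)
    (by
      rintro _ ⟨x, hx, rfl⟩ _ ⟨y, hy, rfl⟩ hxy
      obtain ⟨a, hxa, hay⟩ := h x y hxy
      exact hy (c.val_mono hay (hbc a (b.val_mono hxa hx))))
  refine ⟨s, fun x hx => hs _ ⟨x, hx, rfl⟩, fun y hy => ?_⟩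
  by_contra hn
  exact hs' _ ⟨y, hn, rfl⟩ hy

/-- If there is no interpolant, there are points of the spectra that witness this. -/
theorem exists_of_no_interpolant {f : BoundedLatticeHom A B} {g : BoundedLatticeHom A L} {b : B}
    {c : L} (h : ¬ ∃ a, b ≤ f a ∧ g a ≤ c) :
    ∃ (s : Spec B) (q : Spec L), s.val b = true ∧ ¬ q.val c = true ∧ comap f s ≤ comap g q := by
  -- First `q` is chosen to omit `c` and contain `g a` whenever `b ≤ f a`; then `s` is chosen to
  -- contain `b` and omit `f a` whenever `q` omits `g a`.
  obtain ⟨q, hq, hq'⟩ := exists_separating (L := L) (G := g '' {a | b ≤ f a}) (J := {c})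
    ⟨_, ⊤, by simp, rfl⟩ ⟨c, rfl⟩
    (by
      rintro _ ⟨x, hx, rfl⟩ _ ⟨y, hy, rfl⟩
      exact ⟨x ⊓ y, by simpa using ⟨hx, hy⟩, InfHomClass.map_inf g x y⟩)
    (by
      rintro _ rfl _ rfl
      exact sup_idem _)
    (by
      rintro _ ⟨x, hx, rfl⟩ _ rfl hxc
      exact h ⟨x, hx, hxc⟩)
  obtain ⟨s, hs, hs'⟩ := exists_separating (L := B) (G := {b})
    (J := f '' {a | ¬ q.val (g a) = true}) ⟨b, rfl⟩ ⟨_, ⊥, by simp [q.map_bot], rfl⟩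
    (by
      rintro _ rfl _ rfl
      exact inf_idem _)
    (by
      rintro _ ⟨x, hx, rfl⟩ _ ⟨y, hy, rfl⟩
      refine ⟨x ⊔ y, fun h => ?_, SupHomClass.map_sup f x y⟩
      rw [SupHomClass.map_sup] at h
      exact (q.val_sup_eq_true.1 h).elim hx hy)
    (by
      rintro _ rfl _ ⟨x, hx, rfl⟩ hxb
      exact hx (hq _ ⟨x, hxb, rfl⟩))
  refine ⟨s, q, hs b rfl, hq' c rfl, fun a ha => ?_⟩
  by_contra hn
  exact hs' _ ⟨a, hn, rfl⟩ ha

/-- Semantic content of universal quantification: by adjunction, no `φ a` with `a` in `s` lies below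
`b`, so the two can be separated. -/
theorem exists_le_comap_of_rightAdjoint {φ : BoundedLatticeHom L M} {r : M → L}
    (hr : GaloisConnection φ r) {s : Spec L} {b : M} (hb : ¬ s.val (r b) = true) :
    ∃ t : Spec M, s ≤ comap φ t ∧ ¬ t.val b = true := by
  obtain ⟨t, ht, ht'⟩ := exists_separating (L := M) (G := φ '' {a | s.val a = true}) (J := {b})
    ⟨_, ⊤, s.map_top, rfl⟩ ⟨b, rfl⟩
    (by
      rintro _ ⟨x, hx, rfl⟩ _ ⟨y, hy, rfl⟩
      exact ⟨x ⊓ y, s.val_inf_eq_true.2 ⟨hx, hy⟩, InfHomClass.map_inf φ x y⟩)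
    (by
      rintro _ rfl _ rfl
      exact sup_idem _)
    (by
      rintro _ ⟨x, hx, rfl⟩ _ rfl hxb
      exact hb (s.val_mono (hr.le_u hxb) hx))
  exact ⟨t, fun a ha => ht _ ⟨a, ha, rfl⟩, ht' b rfl⟩

/-- Open up-sets of a spectrum are unions of basic open sets. -/
theorem exists_basic {U : Set (Spec L)} (hU : IsOpen U) (hUu : IsUpperSet U) {s : Spec L}
    (hs : s ∈ U) : ∃ a, s.val a = true ∧ ∀ t : Spec L, t.val a = true → t ∈ U := by
  have hc : IsCompact Uᶜ := hU.isClosed_compl.isCompact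
  obtain ⟨F, hF⟩ := hc.elim_finite_subcover
    (fun a : {a : L // s.val a = true} => {t : Spec L | t.val a.1 = false})
    (fun a => (isOpen_discrete {false}).preimage (continuous_val a.1))
    (by
      intro t ht
      have hn : ¬ s ≤ t := fun h => ht (hUu h hs)
      rw [le_iff] at hn
      push Not at hn
      obtain ⟨a, ha, ha'⟩ := hn
      exact Set.mem_iUnion.2 ⟨⟨a, ha⟩, Bool.eq_false_iff.2 ha'⟩)
  refine ⟨F.inf (fun a => a.1), ?_, fun t ht => ?_⟩
  · refine Finset.inf_induction (p := fun x => s.val x = true) s.map_top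
      (fun x hx y hy => s.val_inf_eq_true.2 ⟨hx, hy⟩) fun a _ => a.2
  · by_contra hn
    obtain ⟨a, ha, hta⟩ := Set.mem_iUnion₂.1 (hF hn)
    have h1 := t.val_mono (Finset.inf_le ha) ht
    have h2 : t.val a.1 = false := hta
    rw [h2] at h1
    exact Bool.false_ne_true h1

end Lattice

section Heyting

variable {L M : Type*} [HeytingAlgebra L] [HeytingAlgebra M]

/-- The bounded lattice homomorphism that underlies a Heyting homomorphism. -/
def _root_.HeytingHom.toBounded (φ : HeytingHom L M) : BoundedLatticeHom L M where
  toFun := φ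
  map_sup' := SupHomClass.map_sup φ
  map_inf' := InfHomClass.map_inf φ
  map_top' := TopHomClass.map_top φ
  map_bot' := BotHomClass.map_bot φ

/-- By adjunction, the filter generated by `s` and `a` avoids `b`. -/
theorem exists_not_himp {s : Spec L} {a b : L} (h : ¬ s.val (a ⇨ b) = true) :
    ∃ t, s ≤ t ∧ t.val a = true ∧ ¬ t.val b = true := by
  obtain ⟨t, ht, ht'⟩ := exists_separating (L := L) (G := (· ⊓ a) '' {x | s.val x = true})
    (J := {b}) ⟨_, ⊤, s.map_top, rfl⟩ ⟨b, rfl⟩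
    (by
      rintro _ ⟨x, hx, rfl⟩ _ ⟨y, hy, rfl⟩
      exact ⟨x ⊓ y, s.val_inf_eq_true.2 ⟨hx, hy⟩, inf_inf_distrib_right x y a⟩)
    (by
      rintro _ rfl _ rfl
      exact sup_idem _)
    (by
      rintro _ ⟨x, hx, rfl⟩ _ rfl hxb
      exact h (s.val_mono (le_himp_iff.2 hxb) hx))
  exact ⟨t, fun x hx => t.val_mono inf_le_left (ht _ ⟨x, hx, rfl⟩),
    t.val_mono inf_le_right (ht _ ⟨⊤, s.map_top, rfl⟩), ht' b rfl⟩

/-- The dual of a Heyting homomorphism is bounded. -/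
theorem isBoundedMap_comap (φ : HeytingHom L M) : IsBoundedMap (comap φ.toBounded) := by
  refine isBoundedMap_iff.2 fun s t hst => ?_
  obtain ⟨x, hx, hx'⟩ := exists_separating (L := M)
    (G := {z | ∃ b a, s.val b = true ∧ t.val a = true ∧ z = b ⊓ φ a})
    (J := φ '' {a | ¬ t.val a = true}) ⟨_, ⊤, ⊤, s.map_top, t.map_top, rfl⟩
    ⟨_, ⊥, by simp [t.map_bot], rfl⟩
    (by
      rintro _ ⟨b, a, hb, ha, rfl⟩ _ ⟨b', a', hb', ha', rfl⟩
      refine ⟨b ⊓ b', a ⊓ a', s.val_inf_eq_true.2 ⟨hb, hb'⟩, t.val_inf_eq_true.2 ⟨ha, ha'⟩, ?_⟩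
      rw [InfHomClass.map_inf, inf_inf_inf_comm])
    (by
      rintro _ ⟨x, hx, rfl⟩ _ ⟨y, hy, rfl⟩
      exact ⟨x ⊔ y, fun h => (t.val_sup_eq_true.1 h).elim hx hy, SupHomClass.map_sup φ x y⟩)
    (by
      rintro _ ⟨b, a, hb, ha, rfl⟩ _ ⟨a', ha', rfl⟩ h
      have h1 : s.val (φ (a ⇨ a')) = true := by
        rw [map_himp]
        exact s.val_mono (le_himp_iff.2 h) hb
      have h2 : t.val (a ⇨ a') = true := hst _ h1
      exact ha' (t.val_mono himp_inf_le (t.val_inf_eq_true.2 ⟨h2, ha⟩)))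
  refine ⟨x, fun b hb => hx _ ⟨b, ⊤, hb, t.map_top, by rw [TopHomClass.map_top, inf_top_eq]⟩, ?_⟩
  refine le_antisymm (fun a ha => ?_) fun a ha =>
    hx _ ⟨⊤, a, s.map_top, ha, (top_inf_eq _).symm⟩
  by_contra hn
  exact hx' _ ⟨a, hn, rfl⟩ ha

/-- Separation gives only a point containing `b` that restricts below `s`; boundedness of the dual
of a Heyting homomorphism raises it to restrict exactly to `s`. -/
theorem exists_comap_eq_of_leftAdjoint {φ : HeytingHom L M} {l : M → L}
    (hl : GaloisConnection l φ) {s : Spec L} {b : M} (hb : s.val (l b) = true) :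
    ∃ t : Spec M, t.val b = true ∧ comap φ.toBounded t = s := by
  obtain ⟨t, ht, ht'⟩ := exists_separating (L := M) (G := {b}) (J := φ '' {a | ¬ s.val a = true})
    ⟨b, rfl⟩ ⟨_, ⊥, by simp [s.map_bot], rfl⟩
    (by
      rintro _ rfl _ rfl
      exact inf_idem _)
    (by
      rintro _ ⟨x, hx, rfl⟩ _ ⟨y, hy, rfl⟩
      exact ⟨x ⊔ y, fun h => (s.val_sup_eq_true.1 h).elim hx hy, SupHomClass.map_sup φ x y⟩)
    (by
      rintro _ rfl _ ⟨x, hx, rfl⟩ hbx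
      exact hx (s.val_mono (hl.l_le hbx) hb))
  have hts : comap φ.toBounded t ≤ s := fun a ha => by
    by_contra hn
    exact ht' _ ⟨a, hn, rfl⟩ ha
  obtain ⟨t', htt', ht's⟩ := isBoundedMap_iff.1 (isBoundedMap_comap φ) t s hts
  exact ⟨t', htt' b (ht b rfl), ht's⟩

/-- Existential quantification is openness: the basic open set of `l b` is contained in the image of
the basic open set of `b`. -/
theorem isLowerSemiOpen_comap {φ : HeytingHom L M} {l : M → L} (hl : GaloisConnection l φ) :
    IsLowerSemiOpen (comap φ.toBounded) := by
  intro U hU hUu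
  refine ⟨?_, isBoundedMap_comap φ U hUu⟩
  refine isOpen_iff_forall_mem_open.2 ?_
  rintro _ ⟨s, hs, rfl⟩
  obtain ⟨b, hb, hbU⟩ := exists_basic hU hUu hs
  refine ⟨{t | t.val (l b) = true}, fun t ht => ?_,
    (isOpen_discrete {true}).preimage (continuous_val (l b)), ?_⟩
  · obtain ⟨t', ht', rfl⟩ := exists_comap_eq_of_leftAdjoint hl ht
    exact ⟨t', hbU t' ht', rfl⟩
  · exact s.val_mono (hl.le_u_l b) hb

end Heyting

end Spec

/-! ### The polyadic space of a hyperdoctrine -/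

/-- The pointwise spectrum of a functor to Heyting algebras. -/
def specFunctor (D : C ⥤ HeytAlg.{w}) : Cᵒᵖ ⥤ KOrd.{w} where
  obj n := ⟨Spec (D.obj n.unop)⟩
  map σ := ⟨Spec.comap (ConcreteCategory.hom (D.map σ.unop)).toBounded⟩
  map_id n := by
    refine KOrd.Hom.ext (ContinuousOrderHom.ext fun s => Spec.ext (funext fun a => ?_))
    change s.val (D.map (𝟙 n.unop) a) = s.val a
    rw [D.map_id]
    rfl
  map_comp f g := by
    refine KOrd.Hom.ext (ContinuousOrderHom.ext fun s => Spec.ext (funext fun a => ?_))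
    change s.val (D.map (g.unop ≫ f.unop) a) = s.val (D.map f.unop (D.map g.unop a))
    rw [D.map_comp]
    rfl

/-- The transformation of spectra that is dual to a natural transformation. -/
def specTrans {D₀ D₁ : C ⥤ HeytAlg.{w}} (a : D₀ ⟶ D₁) :
    KOrdTrans (specFunctor D₁) (specFunctor D₀) where
  app n := Spec.comap (ConcreteCategory.hom (a.app n)).toBounded
  naturality {n m} σ s := by
    refine Spec.ext (funext fun x => ?_)
    change s.val (D₁.map σ (a.app n x)) = s.val (a.app m (D₀.map σ x))
    rw [← ConcreteCategory.comp_apply, ← ConcreteCategory.comp_apply, a.naturality]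

namespace IsIntuitionisticHyperdoctrine

variable {D : C ⥤ HeytAlg.{w}} (hD : IsIntuitionisticHyperdoctrine D)

include hD

theorem isPolyadic : IsPolyadic (specFunctor D) where
  interpolation h := Spec.interpolation_comap (hD.interpolation h)
  bounded _ := Spec.isBoundedMap_comap _

theorem isOpenPolyadic : IsOpenPolyadic (specFunctor D) := by
  intro n m σ
  obtain ⟨l, hl⟩ := hD.exists_leftAdjoint σ
  exact Spec.isLowerSemiOpen_comap hl

end IsIntuitionisticHyperdoctrine

/-- Heyting homomorphisms account for boundedness, and the quantifier conditions dualize to the two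
interpolation properties. -/
theorem IsHyperdoctrineMorphism.isIntuitionistic {D₀ D₁ : C ⥤ HeytAlg.{w}} {a : D₀ ⟶ D₁}
    (ha : IsHyperdoctrineMorphism a) : (specTrans a).IsIntuitionistic where
  isMorphism σ := Spec.interpolation_comap (ha.forth σ)
  bounded _ := Spec.isBoundedMap_comap _
  back σ := Spec.interpolation_comap (ha.back σ)

/-! ### The hyperdoctrine of up-sets -/

namespace Up

variable {A B : Type*} [Preorder A] [Preorder B]

theorem mem_himp {U V : Up A} {z : A} :
    z ∈ (U ⇨ V).carrier ↔ ∀ z', z ≤ z' → z' ∈ U.carrier → z' ∈ V.carrier := by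
  have h1 : z ∈ (U ⇨ V).carrier ↔ of (Set.Ici z) (isUpperSet_Ici z) ≤ U ⇨ V :=
    ⟨fun h y hy => (U ⇨ V).isUpperSet_carrier hy h, fun h => h (Set.self_mem_Ici (a := z))⟩
  rw [h1, le_himp_iff]
  exact ⟨fun h z' hz hz' => h ⟨hz, hz'⟩, fun h z' hz' => h z' hz'.1 hz'.2⟩

/-- Preimages of up-sets under a bounded order-preserving map form a Heyting homomorphism. -/
def comapHom (f : A →o B) (hf : IsBoundedMap f) : HeytingHom (Up B) (Up A) where
  toFun := comap f
  map_sup' _ _ := rfl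
  map_inf' _ _ := rfl
  map_bot' := rfl
  map_himp' U V := ext (by
    ext z
    change f z ∈ (U ⇨ V).carrier ↔ _
    rw [mem_himp, mem_himp]
    constructor
    · exact fun h z' hz => h (f z') (f.monotone hz)
    · intro h y hy hyU
      obtain ⟨z', hz', rfl⟩ := isBoundedMap_iff.1 hf z y hy
      exact h z' hz' hyU)

end Up

section UpFunctor

variable {K : Cᵒᵖ ⥤ Preord.{w}} (hK : ∀ {n m : C} (σ : n ⟶ m), IsBoundedMap (K.map σ.op))

/-- The functor of up-sets of a presheaf of preorders with bounded restriction maps. -/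
def upFunctor : C ⥤ HeytAlg.{w} where
  obj n := HeytAlg.of (Up (K.obj (op n)))
  map σ := HeytAlg.ofHom (Up.comapHom (K.map σ.op).hom (hK σ))
  map_id n := by
    refine HeytAlg.ext fun U => Up.ext ?_
    change K.map (𝟙 n).op ⁻¹' Up.carrier U = Up.carrier U
    rw [op_id, K.map_id]
    rfl
  map_comp f g := by
    refine HeytAlg.ext fun U => Up.ext ?_
    change K.map (f ≫ g).op ⁻¹' Up.carrier U = K.map g.op ⁻¹' (K.map f.op ⁻¹' Up.carrier U)
    rw [op_comp, K.map_comp]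
    rfl

/-- Direct image is the existential quantifier, since boundedness keeps it an up-set, and it also
provides the interpolant for a pushout square. -/
theorem upFunctor_isIntuitionisticHyperdoctrine
    (hP : ∀ {n m m' k : C} {f : n ⟶ m} {g : n ⟶ m'} {a : m ⟶ k} {b : m' ⟶ k},
      IsPushout f g a b →
        Interpolation (K.map a.op) (K.map b.op) (K.map f.op) (K.map g.op)) :
    IsIntuitionisticHyperdoctrine (upFunctor hK) where
  interpolation {n m m' k f g a b} h := by
    intro (U : Up (K.obj (op m))) (V : Up (K.obj (op m'))) hUV
    refine ⟨Up.of (K.map f.op '' U.carrier) (hK f _ U.isUpperSet_carrier),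
      fun z hz => ⟨z, hz, rfl⟩, ?_⟩
    rintro z' ⟨z, hz, hzz'⟩
    obtain ⟨y, hy, hy'⟩ := hP h z z' hzz'.le
    exact V.isUpperSet_carrier hy' (hUV (show y ∈ Up.carrier (Up.comap (K.map a.op).hom U) from
      U.isUpperSet_carrier hy hz))
  exists_leftAdjoint {n m} σ :=
    ⟨fun U => Up.of (K.map σ.op '' Up.carrier U) (hK σ _ (Up.isUpperSet_carrier U)),
      fun _ _ => Set.image_subset_iff⟩
  exists_rightAdjoint {n m} σ := by
    refine ⟨fun U => Up.of {z | ∀ z' : K.obj (op m), z ≤ K.map σ.op z' → z' ∈ Up.carrier U}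
      fun z y hzy hz z' hz' => hz z' (hzy.trans hz'), fun V U => ⟨?_, ?_⟩⟩
    · exact fun h z hz z' hz' => h (Up.isUpperSet_carrier V hz' hz)
    · exact fun h z hz => h hz z le_rfl

variable {D : C ⥤ HeytAlg.{w}} (π : OrdTrans K (specFunctor D))

/-- The value of a formula: the up-set of elements whose type contains it. -/
def OrdTrans.value {n : C} (φ : D.obj n) : Up (K.obj (op n)) :=
  Up.of {z | Spec.val (π.app n z) φ = true} fun _ _ h hz => (π.app n).monotone h φ hz

theorem OrdTrans.mem_value {n : C} {φ : D.obj n} {z : K.obj (op n)} :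
    z ∈ (π.value φ).carrier ↔ Spec.val (π.app n z) φ = true := Iff.rfl

/-- The interpretation of formulas by up-sets. -/
def OrdTrans.interpretation (hπ : ∀ n, IsBoundedMap (π.app n)) : D ⟶ upFunctor hK where
  app n := HeytAlg.ofHom
    { toFun := π.value
      map_sup' := fun φ ψ => Up.ext (Set.ext fun z => Spec.val_sup_eq_true (π.app n z))
      map_inf' := fun φ ψ => Up.ext (Set.ext fun z => Spec.val_inf_eq_true (π.app n z))
      map_bot' := Up.ext (Set.eq_empty_iff_forall_notMem.2 fun z hz =>
        Bool.false_ne_true ((Spec.map_bot (π.app n z)).symm.trans hz))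
      map_himp' := fun φ ψ => Up.ext (Set.ext fun z => by
        rw [Up.mem_himp, OrdTrans.mem_value]
        constructor
        · intro h z' hz' hφ
          exact Spec.val_mono (π.app n z') himp_inf_le ((Spec.val_inf_eq_true (π.app n z')).2
            ⟨(π.app n).monotone hz' _ h, hφ⟩)
        · intro h
          by_contra hn
          obtain ⟨t, ht, htφ, htψ⟩ := Spec.exists_not_himp hn
          obtain ⟨z', hz', rfl⟩ := isBoundedMap_iff.1 (hπ n) z t ht
          exact htψ (h z' hz' htφ)) }
  naturality n m σ := by
    refine HeytAlg.ext fun φ => Up.ext (Set.ext fun z => ?_)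
    change Spec.val (π.app m z) (D.map σ φ) = true ↔ Spec.val (π.app n (K.map σ.op z)) φ = true
    rw [π.naturality]
    rfl

/-- The interpolants are the quantified formulas `l φ` and `r φ`. Witnesses show that `l φ` holds
only where a witness exists; the universal Kripke condition shows that failure of `r φ` is seen at
some later point. -/
theorem OrdTrans.interpretation_isHyperdoctrineMorphism (hD : IsIntuitionisticHyperdoctrine D)
    (hπ : ∀ n, IsBoundedMap (π.app n)) (hw : π.Witnessing)
    (hu : ∀ {n m : C} (σ : n ⟶ m),
      Interpolation (K.map σ.op) (π.app m) (π.app n) ((specFunctor D).map σ.op)) :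
    IsHyperdoctrineMorphism (π.interpretation hK hπ) where
  forth {n m} σ := by
    intro φ (V : Up (K.obj (op n))) hφV
    obtain ⟨l, hl⟩ := hD.exists_leftAdjoint σ
    refine ⟨l φ, hl.le_u_l φ, fun z hz => ?_⟩
    obtain ⟨t, ht, htz⟩ := Spec.exists_comap_eq_of_leftAdjoint hl hz
    obtain ⟨z', hz', hzz'⟩ := hw σ {s : Spec (D.obj m) | s.val φ = true}
      ((isOpen_discrete {true}).preimage (Spec.continuous_val φ)) (fun s s' h hs => h φ hs)
      z t ht htz
    exact V.isUpperSet_carrier hzz' (hφV hz')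
  back {n m} σ := by
    intro (V : Up (K.obj (op n))) φ hVφ
    obtain ⟨r, hr⟩ := hD.exists_rightAdjoint σ
    refine ⟨r φ, fun z hz => ?_, hr.l_u_le φ⟩
    by_contra hn
    obtain ⟨t, ht, htφ⟩ := Spec.exists_le_comap_of_rightAdjoint
      (φ := (ConcreteCategory.hom (D.map σ)).toBounded) hr hn
    obtain ⟨z', hz', hz't⟩ := hu σ z t ht
    exact htφ (hz't φ (hVφ (V.isUpperSet_carrier hz' hz)))

end UpFunctor

/-! ### Oplax colimits of ind-objects -/

/-- Ind-objects send pushouts to weak pullbacks. -/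
theorem exists_of_isPushout {X : Cᵒᵖ ⥤ Type v} (hX : IsIndObject X) {n m m' k : C} {f : n ⟶ m}
    {g : n ⟶ m'} {a : m ⟶ k} {b : m' ⟶ k} (sq : IsPushout f g a b) {p : X.obj (op m)}
    {p' : X.obj (op m')} (h : X.map f.op p = X.map g.op p') :
    ∃ q : X.obj (op k), X.map a.op q = p ∧ X.map b.op q = p' := by
  obtain ⟨R⟩ := exists_directedPresentation hX
  obtain ⟨i, c, rfl⟩ := R.exists_rep p
  obtain ⟨i', c', rfl⟩ := R.exists_rep p'
  obtain ⟨j, hj, hj'⟩ := exists_ge_ge i i'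
  -- Both points are moved to a common stage. Their restrictions become equal as arrows at a later
  -- stage, where the pushout induces the required arrow.
  rw [← R.map_pt (homOfLE hj), ← R.map_pt (homOfLE hj')] at h ⊢
  simp only [← presheaf_map_comp_apply] at h ⊢
  obtain ⟨l, e, he⟩ := R.exists_eq _ _ h
  rw [← R.map_pt e]
  refine ⟨X.map (sq.desc (c ≫ R.D.map (homOfLE hj) ≫ R.D.map e)
    (c' ≫ R.D.map (homOfLE hj') ≫ R.D.map e) (by simpa using he)).op (R.pt l), ?_, ?_⟩
  · rw [← presheaf_map_comp_apply, sq.inl_desc, ← presheaf_map_comp_apply, Category.assoc]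
  · rw [← presheaf_map_comp_apply, sq.inr_desc, ← presheaf_map_comp_apply, Category.assoc]

section Oplax

variable {I : Type u₁} [Category.{v₁} I] (F : I ⥤ Cᵒᵖ ⥤ Type v)

theorem isBoundedMap_oplaxColimit_map {n m : C} (σ : n ⟶ m) :
    IsBoundedMap ((oplaxColimit F).map σ.op) := by
  refine isBoundedMap_iff.2 ?_
  rintro ⟨i, p⟩ ⟨j, q⟩ ⟨h, hh⟩
  refine ⟨⟨j, (F.map h).app (op m) p⟩, ⟨h, rfl⟩, Sigma.ext rfl (heq_of_eq ?_)⟩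
  exact (presheaf_hom_naturality (F.map h) σ p).symm.trans hh

/-- An inequality moves the first point into the ind-object of the second, where the weak pullback
property applies. -/
theorem interpolation_oplaxColimit (hF : ∀ i, IsIndObject (F.obj i)) {n m m' k : C} {f : n ⟶ m}
    {g : n ⟶ m'} {a : m ⟶ k} {b : m' ⟶ k} (sq : IsPushout f g a b) :
    Interpolation ((oplaxColimit F).map a.op) ((oplaxColimit F).map b.op)
      ((oplaxColimit F).map f.op) ((oplaxColimit F).map g.op) := by
  rintro ⟨i, p⟩ ⟨j, p'⟩ ⟨h, hh⟩
  obtain ⟨q, hq, hq'⟩ := exists_of_isPushout (hF j) sq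
    ((presheaf_hom_naturality (F.map h) f p).symm.trans hh)
  exact ⟨⟨j, q⟩, ⟨h, hq.symm⟩, le_of_eq (Sigma.ext rfl (heq_of_eq hq'))⟩

end Oplax

/-! ### Small families of agreeing pairs -/

/-- A small family can be closed under small families of operations. -/
theorem exists_closed_family {T : Type w₁} {B : Type w} (base : B → T) {N : T → Type w}
    (next : ∀ A, N A → T) :
    ∃ (I : Type w) (F : I → T), (∀ b, ∃ i, F i = base b) ∧
      ∀ i (k : N (F i)), ∃ j, F j = next (F i) k := by
  -- Each level consists of the results of all operations on the previous one; the family is the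
  -- disjoint union of the levels.
  let level : ℕ → Σ I : Type w, I → T := fun n => Nat.rec ⟨B, base⟩
    (fun _ L => ⟨Σ i : L.1, N (L.2 i), fun x => next (L.2 x.1) x.2⟩) n
  exact ⟨Σ n, (level n).1, fun x => (level x.1).2 x.2, fun b => ⟨⟨0, b⟩, rfl⟩,
    fun i k => ⟨⟨i.1 + 1, ⟨i.2, k⟩⟩, rfl⟩⟩

section Transport

variable {X Y : Cᵒᵖ ⥤ Type v} {S : Cᵒᵖ ⥤ KOrd.{w}} {n m n' m' : C}

/-- Together with `exists_of_iso`, this moves an extension problem to isomorphic objects and its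
solution back, so that only problems over a small model need be solved. -/
theorem le_of_iso (x : TypeOver X S) (i : n ≅ n') (j : m ≅ m') {σ : n ⟶ m} {p : X.obj (op n)}
    {t : S.obj (op m)} (h : x.app n p ≤ S.map σ.op t) :
    x.app n' (X.map i.inv.op p) ≤ S.map (i.inv ≫ σ ≫ j.hom).op (S.map j.inv.op t) := by
  rw [← KOrd.map_comp_apply, Category.assoc, Category.assoc, Iso.hom_inv_id, Category.comp_id,
    KOrd.map_comp_apply, x.naturality]
  exact KOrd.monotone_map _ h

theorem exists_of_iso (e : X ⟶ Y) (y : TypeOver Y S) (i : n ≅ n') (j : m ≅ m') {σ : n ⟶ m}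
    {p : X.obj (op n)} {t : S.obj (op m)} (h : ∃ p' : Y.obj (op m'),
      Y.map (i.inv ≫ σ ≫ j.hom).op p' = e.app (op n') (X.map i.inv.op p) ∧
        y.app m' p' = S.map j.inv.op t) :
    ∃ p' : Y.obj (op m), Y.map σ.op p' = e.app (op n) p ∧ y.app m p' = t := by
  obtain ⟨p', hp', hyp'⟩ := h
  refine ⟨Y.map j.hom.op p', ?_, ?_⟩
  · have h2 : σ ≫ j.hom = i.hom ≫ i.inv ≫ σ ≫ j.hom := by simp
    rw [← presheaf_map_comp_apply, h2, presheaf_map_comp_apply, hp', ← presheaf_hom_naturality,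
      ← presheaf_map_comp_apply, Iso.hom_inv_id, presheaf_map_id_apply]
  · rw [y.naturality, hyp', ← KOrd.map_comp_apply, Iso.hom_inv_id, KOrd.map_id_apply]

theorem KOrd.map_hom_inv_apply (S : Cᵒᵖ ⥤ KOrd.{w}) (i : n ≅ n') (s : S.obj (op n)) :
    S.map i.hom.op (S.map i.inv.op s) = s := by
  rw [← KOrd.map_comp_apply, Iso.hom_inv_id, KOrd.map_id_apply]

end Transport

/-- There is a small family of agreeing pairs of models that realizes all compatible pairs of
elements and is closed under the extensions required of Kripke models. -/
theorem AgreeingPair.exists_small_family [EssentiallySmall.{v} C] [HasPushouts C]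
    {S P Q : Cᵒᵖ ⥤ KOrd.{v}} (hS : IsPolyadic S) (hQ : IsPolyadic Q) (hSo : IsOpenPolyadic S)
    (hQo : IsOpenPolyadic Q) {f : KOrdTrans S P} {g : KOrdTrans Q P} (hf : f.IsIntuitionistic)
    (hg : g.IsIntuitionistic) :
    ∃ (I : Type v) (F : I → AgreeingPair f g),
      (∀ {n : C} {s : S.obj (op n)} {q : Q.obj (op n)}, g.app n q ≤ f.app n s →
        ∃ (i : I) (p : (F i).X.obj (op n)), q ≤ (F i).right.app n p ∧ (F i).left.app n p = s) ∧
      (∀ {n : C} {s : S.obj (op n)} {q : Q.obj (op n)}, f.app n s ≤ g.app n q →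
        ∃ (i : I) (p : (F i).X.obj (op n)), s ≤ (F i).left.app n p ∧ (F i).right.app n p = q) ∧
      (∀ (i : I) {n m : C} (σ : n ⟶ m) (p : (F i).X.obj (op n)) (t : S.obj (op m)),
        (F i).left.app n p ≤ S.map σ.op t →
          ∃ (j : I) (a : Hom (F i) (F j)) (p' : (F j).X.obj (op m)),
            (F j).X.map σ.op p' = a.hom.app (op n) p ∧ (F j).left.app m p' = t) ∧
      (∀ (i : I) {n m : C} (σ : n ⟶ m) (p : (F i).X.obj (op n)) (t : Q.obj (op m)),
        (F i).right.app n p ≤ Q.map σ.op t →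
          ∃ (j : I) (a : Hom (F i) (F j)) (p' : (F j).X.obj (op m)),
            (F j).X.map σ.op p' = a.hom.app (op n) p ∧ (F j).right.app m p' = t) := by
  let R : C → SmallModel.{v} C := (equivSmallModel C).functor.obj
  let E : SmallModel.{v} C → C := (equivSmallModel C).inverse.obj
  let iso : ∀ n : C, n ≅ E (R n) := (equivSmallModel C).unitIso.app
  let Bl : Type v := Σ n, {t : S.obj (op (E n)) × Q.obj (op (E n)) // g.app _ t.2 ≤ f.app _ t.1}
  let Br : Type v := Σ n, {t : S.obj (op (E n)) × Q.obj (op (E n)) // f.app _ t.1 ≤ g.app _ t.2}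
  let Nl : AgreeingPair f g → Type v := fun A => Σ n m,
    {t : (E n ⟶ E m) × A.X.obj (op (E n)) × S.obj (op (E m)) //
      A.left.app _ t.2.1 ≤ S.map t.1.op t.2.2}
  let Nr : AgreeingPair f g → Type v := fun A => Σ n m,
    {t : (E n ⟶ E m) × A.X.obj (op (E n)) × Q.obj (op (E m)) //
      A.right.app _ t.2.1 ≤ Q.map t.1.op t.2.2}
  choose bl hbl using fun b : Bl => exists_point_left hS hQ hSo hQo hf hg b.2.2
  choose br hbr using fun b : Br => exists_point_right hS hQ hSo hQo hf hg b.2.2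
  choose nl hnl using fun A (k : Nl A) =>
    exists_extension_left hS hQ hSo hQo hf hg A k.2.2.1.1 k.2.2.1.2.1 k.2.2.2
  choose nr hnr using fun A (k : Nr A) =>
    exists_extension_right hS hQ hSo hQo hf hg A k.2.2.1.1 k.2.2.1.2.1 k.2.2.2
  obtain ⟨I, F, hb, hn⟩ := exists_closed_family (Sum.elim bl br) (N := fun A => Nl A ⊕ Nr A)
    fun A => Sum.elim (nl A) (nr A)
  refine ⟨I, F, ?_, ?_, ?_, ?_⟩
  · intro n s q h
    let b : Bl := ⟨R n, (S.map (iso n).inv.op s, Q.map (iso n).inv.op q), by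
      rw [g.naturality, f.naturality]
      exact KOrd.monotone_map _ h⟩
    obtain ⟨i, hi⟩ := hb (Sum.inl b)
    have hspec := hbl b
    change F i = bl b at hi
    rw [← hi] at hspec
    obtain ⟨p, hp, hp'⟩ := hspec
    refine ⟨i, (F i).X.map (iso n).hom.op p, ?_, ?_⟩
    · rw [(F i).right.naturality, ← KOrd.map_hom_inv_apply Q (iso n) q]
      exact KOrd.monotone_map _ hp
    · rw [(F i).left.naturality, hp']
      exact KOrd.map_hom_inv_apply S (iso n) s
  · intro n s q h
    let b : Br := ⟨R n, (S.map (iso n).inv.op s, Q.map (iso n).inv.op q), by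
      rw [g.naturality, f.naturality]
      exact KOrd.monotone_map _ h⟩
    obtain ⟨i, hi⟩ := hb (Sum.inr b)
    have hspec := hbr b
    change F i = br b at hi
    rw [← hi] at hspec
    obtain ⟨p, hp, hp'⟩ := hspec
    refine ⟨i, (F i).X.map (iso n).hom.op p, ?_, ?_⟩
    · rw [(F i).left.naturality, ← KOrd.map_hom_inv_apply S (iso n) s]
      exact KOrd.monotone_map _ hp
    · rw [(F i).right.naturality, hp']
      exact KOrd.map_hom_inv_apply Q (iso n) q
  · intro i n m σ p t h
    let k : Nl (F i) := ⟨R n, R m, ((iso n).inv ≫ σ ≫ (iso m).hom, (F i).X.map (iso n).inv.op p,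
      S.map (iso m).inv.op t), le_of_iso (F i).left (iso n) (iso m) h⟩
    obtain ⟨j, hj⟩ := hn i (Sum.inl k)
    have hspec := hnl (F i) k
    change F j = nl (F i) k at hj
    rw [← hj] at hspec
    obtain ⟨a, ha⟩ := hspec
    exact ⟨j, a, exists_of_iso a.hom (F j).left (iso n) (iso m) ha⟩
  · intro i n m σ p t h
    let k : Nr (F i) := ⟨R n, R m, ((iso n).inv ≫ σ ≫ (iso m).hom, (F i).X.map (iso n).inv.op p,
      Q.map (iso m).inv.op t), le_of_iso (F i).right (iso n) (iso m) h⟩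
    obtain ⟨j, hj⟩ := hn i (Sum.inr k)
    have hspec := hnr (F i) k
    change F j = nr (F i) k at hj
    rw [← hj] at hspec
    obtain ⟨a, ha⟩ := hspec
    exact ⟨j, a, exists_of_iso a.hom (F j).right (iso n) (iso m) ha⟩

/-- Spans of intuitionistic hyperdoctrines can be completed to squares with the interpolation
property in both directions. -/
theorem IsHyperdoctrineMorphism.exists_amalgam [EssentiallySmall.{v} C] [HasPushouts C]
    {D₀ D₁ D₂ : C ⥤ HeytAlg.{v}} (h₁ : IsIntuitionisticHyperdoctrine D₁)
    (h₂ : IsIntuitionisticHyperdoctrine D₂) {a : D₀ ⟶ D₁} {b : D₀ ⟶ D₂}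
    (ha : IsHyperdoctrineMorphism a) (hb : IsHyperdoctrineMorphism b) :
    ∃ (E : C ⥤ HeytAlg.{v}) (c : D₁ ⟶ E) (d : D₂ ⟶ E),
      IsIntuitionisticHyperdoctrine E ∧ IsHyperdoctrineMorphism c ∧
      IsHyperdoctrineMorphism d ∧ a ≫ c = b ≫ d ∧
      (∀ n : C, Interpolation (a.app n) (b.app n) (c.app n) (d.app n)) ∧
      (∀ n : C, Interpolation (b.app n) (a.app n) (d.app n) (c.app n)) := by
  obtain ⟨I, F, hl, hr, hel, her⟩ := AgreeingPair.exists_small_family h₁.isPolyadic h₂.isPolyadic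
    h₁.isOpenPolyadic h₂.isOpenPolyadic ha.isIntuitionistic hb.isIntuitionistic
  -- The category of all agreeing pairs is too large to index an `E` with values in the given
  -- universe. The full subcategory on the small family still satisfies the Kripke conditions.
  let J := InducedCategory (AgreeingPair (specTrans a) (specTrans b)) F
  let Gl : J ⥤ Model (specFunctor D₁) := inducedFunctor F ⋙ AgreeingPair.projLeft _ _
  let Gr : J ⥤ Model (specFunctor D₂) := inducedFunctor F ⋙ AgreeingPair.projRight _ _
  have kl : KripkeConditions Gl := kripkeConditions_of_exists fun i _ _ σ p t h => by
    obtain ⟨j, e, he⟩ := hel i σ p t h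
    exact ⟨j, ⟨e⟩, he⟩
  have kr : KripkeConditions Gr := kripkeConditions_of_exists fun i _ _ σ p t h => by
    obtain ⟨j, e, he⟩ := her i σ p t h
    exact ⟨j, ⟨e⟩, he⟩
  let K : Cᵒᵖ ⥤ Preord.{v} := oplaxColimit (Gl ⋙ Model.forget _)
  have hK : ∀ {n m : C} (σ : n ⟶ m), IsBoundedMap (K.map σ.op) :=
    fun σ => isBoundedMap_oplaxColimit_map _ σ
  let πl : OrdTrans K (specFunctor D₁) := diagramTrans Gl
  -- Both projections keep the underlying ind-object, so `K` serves for both interpretations.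
  let πr : OrdTrans K (specFunctor D₂) := diagramTrans Gr
  let c : D₁ ⟶ upFunctor hK := πl.interpretation hK kl.implication
  let d : D₂ ⟶ upFunctor hK := πr.interpretation hK kr.implication
  refine ⟨upFunctor hK, c, d, upFunctor_isIntuitionisticHyperdoctrine hK
    (fun sq => interpolation_oplaxColimit _ (fun i => (Gl.obj i).isInd) sq),
    πl.interpretation_isHyperdoctrineMorphism hK h₁ kl.implication (diagramTrans_witnessing Gl)
      kl.universal,
    πr.interpretation_isHyperdoctrineMorphism hK h₂ kr.implication (diagramTrans_witnessing Gr)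
      kr.universal, ?_, ?_, ?_⟩
  · ext n θ
    refine Up.ext (Set.ext ?_)
    rintro ⟨i, p⟩
    have h := congrArg (fun s : Spec (D₀.obj n) => s.val θ = true) ((F i).agree n p)
    exact iff_of_eq h
  · intro n φ ψ h
    by_contra hn
    obtain ⟨s, q, hs, hq, hsq⟩ := Spec.exists_of_no_interpolant
      (f := (ConcreteCategory.hom (a.app n)).toBounded)
      (g := (ConcreteCategory.hom (b.app n)).toBounded) hn
    -- The realized point lies in the value of `φ`, because its left type is above `s`, but not in
    -- that of `ψ`, because its right type is `q`.
    obtain ⟨i, p, hp, rfl⟩ := hr hsq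
    exact hq (h (show (⟨i, p⟩ : OplaxPoint (Gl ⋙ Model.forget _) (op n)) ∈ Up.carrier (c.app n φ)
      from hp φ hs))
  · intro n ψ φ h
    by_contra hn
    obtain ⟨q, s, hq, hs, hqs⟩ := Spec.exists_of_no_interpolant
      (f := (ConcreteCategory.hom (b.app n)).toBounded)
      (g := (ConcreteCategory.hom (a.app n)).toBounded) hn
    obtain ⟨i, p, hp, rfl⟩ := hl hqs
    exact hs (h (show (⟨i, p⟩ : OplaxPoint (Gl ⋙ Model.forget _) (op n)) ∈ Up.carrier (d.app n ψ)
      from hp ψ hq))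

end Polyadic

/-! ### Craig interpolation for polyadic spaces and for hyperdoctrines -/

theorem mainTheorem8 {C : Type u} [Category.{v} C] [EssentiallySmall.{v} C] [HasPushouts C] :
    (∀ (S P Q : Cᵒᵖ ⥤ Polyadic.KOrd.{v}),
      Polyadic.IsPolyadic S → Polyadic.IsPolyadic P → Polyadic.IsPolyadic Q →
      Polyadic.IsOpenPolyadic S → Polyadic.IsOpenPolyadic Q →
      ∀ (f : Polyadic.KOrdTrans S P) (g : Polyadic.KOrdTrans Q P),
      f.IsIntuitionistic → g.IsIntuitionistic →
        Polyadic.KripkeConditions (Polyadic.AgreeingPair.projLeft f g) ∧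
        Polyadic.KripkeConditions (Polyadic.AgreeingPair.projRight f g) ∧
        (Polyadic.IsIntuitionisticPolyadic S →
          Polyadic.IsKripkeModel (Polyadic.AgreeingPair.projLeft f g)) ∧
        (Polyadic.IsIntuitionisticPolyadic Q →
          Polyadic.IsKripkeModel (Polyadic.AgreeingPair.projRight f g)) ∧
        (∀ n : C, Polyadic.Interpolation
          (fun z : Polyadic.AgreeingPair.Point f g n => z.left) (fun z => z.right)
          (f.app n) (g.app n)) ∧
        (∀ n : C, Polyadic.Interpolation
          (fun z : Polyadic.AgreeingPair.Point f g n => z.right) (fun z => z.left)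
          (g.app n) (f.app n))) ∧
    (∀ (D₀ D₁ D₂ : C ⥤ HeytAlg.{v}),
      Polyadic.IsIntuitionisticHyperdoctrine D₀ → Polyadic.IsIntuitionisticHyperdoctrine D₁ →
      Polyadic.IsIntuitionisticHyperdoctrine D₂ →
      ∀ (a : D₀ ⟶ D₁) (b : D₀ ⟶ D₂),
      Polyadic.IsHyperdoctrineMorphism a → Polyadic.IsHyperdoctrineMorphism b →
        (∃ (E : C ⥤ HeytAlg.{v}) (c : D₁ ⟶ E) (d : D₂ ⟶ E),
          Polyadic.IsIntuitionisticHyperdoctrine E ∧ Polyadic.IsHyperdoctrineMorphism c ∧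
          Polyadic.IsHyperdoctrineMorphism d ∧ a ≫ c = b ≫ d ∧
          (∀ n : C, Polyadic.Interpolation (a.app n) (b.app n) (c.app n) (d.app n)) ∧
          (∀ n : C, Polyadic.Interpolation (b.app n) (a.app n) (d.app n) (c.app n))) ∧
        (∀ (n : C) (φ : D₁.obj n) (ψ : D₂.obj n),
          (∀ (E : C ⥤ HeytAlg.{v}) (c : D₁ ⟶ E) (d : D₂ ⟶ E),
            Polyadic.IsIntuitionisticHyperdoctrine E → Polyadic.IsHyperdoctrineMorphism c →
            Polyadic.IsHyperdoctrineMorphism d → a ≫ c = b ≫ d → c.app n φ ≤ d.app n ψ) →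
          ∃ θ : D₀.obj n, φ ≤ a.app n θ ∧ b.app n θ ≤ ψ)) := by
  refine ⟨fun S P Q hS _ hQ hSo hQo f g hf hg =>
    Polyadic.AgreeingPair.craig_interpolation hS hQ hSo hQo hf hg,
    fun D₀ D₁ D₂ _ h₁ h₂ a b ha hb => ?_⟩
  obtain ⟨E, c, d, hE, hc, hd, hcd, hl, hr⟩ :=
    Polyadic.IsHyperdoctrineMorphism.exists_amalgam h₁ h₂ ha hb
  exact ⟨⟨E, c, d, hE, hc, hd, hcd, hl, hr⟩,
    fun n φ ψ h => hl n φ ψ (h E c d hE hc hd hcd)⟩
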